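/- Online portfolio selection. There are $N\ge 1$ stocks and a known horizon of $T>N$ rounds. In round $t=1,\dots,T$ the learner chooses $x_t\in\Delta_N=\{x\in\mathbb R^N: x_i\ge 0,\ \sum_i x_i=1\}$, and then observes a price relative vector $r_t\in\mathbb R_{\ge 0}^N\setminus\{0\}$, chosen arbitrarily by an adversary. The loss is $f_t(x)=-\ln\langle x,r_t\rangle\in(-\infty,+\infty]$, and for $u\in\Delta_N$ the regret is $\mathrm{Reg}(u)=\sum_{t=1}^T f_t(x_t)-\sum_{t=1}^T f_t(u)\in[-\infty,+\infty]$. Let $\bar\Delta_N=\{x\in\Delta_N: x_i\ge \frac1{NT}\ \forall i\}$. BARRONS with parameters $\beta,\eta>0$ starts at $x_1=(\frac1N,\dots,\frac1N)$. With $\nabla_s=\nabla f_s(x_s)=-r_s/\langle x_s,r_s\rangle$, it puts $$A_t=N I_N+\sum_{s\le t}\nabla_s\nabla_s^\top,\qquad \eta_{t,i}=\eta\exp\Big(\max_{s\le t}\log_T\tfrac1{N x_{s,i}}\Big),\qquad \psi_t(x)=\tfrac\beta2x^\top A_t x+\sum_{i=1}^N\tfrac1{\eta_{t,i}}\ln\tfrac1{x_i},$$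 and plays $x_{t+1}=\operatorname{argmin}_{x\in\bar\Delta_N}\ \langle x,\nabla_t\rangle+D_{\psi_t}(x,x_t)$, where $D_\psi(x,y)=\psi(x)-\psi(y)-\langle\nabla\psi(y),x-y\rangle$. Ada-BARRONS sets $\beta=\frac12$, $\eta=\frac1{2048N(\ln T)^2}$, $\gamma=\frac1{25}$ and runs BARRONS with parameters $\beta,\eta$. After each round $t$ it computes $$u_t=\operatorname{argmin}_{u\in\bar\Delta_N}\ \sum_{s=1}^t f_s(u)+\frac1\gamma\sum_{i=1}^N\ln\frac1{u_i}.$$ If $\beta>\alpha_t(u_t)$, where $\alpha_t(u)=\min\big\{\frac12,\ \min_{s\le t}\frac1{8|(u-x_s)^\top\nabla_s|}\big\}$ with $\frac10=+\infty$, then $\beta$ is replaced by $\beta/2$ and BARRONS is rerun from scratch with the new $\beta$ in the following rounds. The time index is then reset to $1$ and all previous data are forgotten, so that $x_s,r_s,\nabla_s,u_t,\alpha_t$ refer to the current run only; $T$ and $\eta$ are unchanged. Theorem. There is an absolute constant $C>0$ such that for all $N\ge1$, all $T>N$, all such sequences $r_1,\dots,r_T$ and all $u\in\Delta_N$, the plays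 of Ada-BARRONS satisfy $$\mathrm{Reg}(u)\le C\,N^2(\ln T)^4 .$$ In particular, the bound does not depend on the largest gradient norm $G=\max_{t\in[T]}\|\nabla f_t(x_t)\|_\infty$. -/

import Mathlib

open scoped ENNReal Matrix

noncomputable section

namespace AdaBarrons

/-! Rounds are numbered from `0`, so that "round `t`" below is round `t + 1` when counting from `1`,
and the rounds up to and including round `t` are those in `Finset.range (t + 1)`.
`x ⬝ᵥ y` is the inner product of `x, y : Fin N → ℝ`. -/

/-- The loss `f(x) = -ln ⟨x, r⟩` of the portfolio `x` at the price relative vector `r`, as a real number.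
It is used only for portfolios with all coordinates positive, for which `⟨x, r⟩ > 0`. -/
def loss {N : ℕ} (r x : Fin N → ℝ) : ℝ := -Real.log (x ⬝ᵥ r)

/-- The loss `f(x) = -ln ⟨x, r⟩` with values in the extended reals: it is `+∞` if `⟨x, r⟩ = 0`. -/
def extLoss {N : ℕ} (r x : Fin N → ℝ) : EReal := -ENNReal.log (ENNReal.ofReal (x ⬝ᵥ r))

theorem extLoss_eq_loss {N : ℕ} {r x : Fin N → ℝ} (h : 0 < x ⬝ᵥ r) :
    extLoss r x = (loss r x : EReal) := by
  rw [extLoss, loss, ENNReal.log_ofReal_of_pos h, EReal.coe_neg]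

theorem extLoss_eq_top {N : ℕ} {r x : Fin N → ℝ} (h : x ⬝ᵥ r = 0) : extLoss r x = ⊤ := by
  simp [extLoss, h]

/-- The regret over `T` rounds of the plays `x` against the constant-rebalanced portfolio `u`. -/
def regret {N : ℕ} (T : ℕ) (r x : ℕ → Fin N → ℝ) (u : Fin N → ℝ) : EReal :=
  (∑ t ∈ Finset.range T, extLoss (r t) (x t)) - (∑ t ∈ Finset.range T, extLoss (r t) u)

/-- The gradient `-r / ⟨x, r⟩` of `loss r` at `x`. -/
def lossGrad {N : ℕ} (r x : Fin N → ℝ) : Fin N → ℝ := fun i => -r i / (x ⬝ᵥ r)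

theorem hasFDerivAt_loss {N : ℕ} {r x : Fin N → ℝ} (h : 0 < x ⬝ᵥ r) :
    HasFDerivAt (loss r) (LinearMap.toContinuousLinearMap (dotProductBilin ℝ ℝ (lossGrad r x))) x := by
  have h1 : HasFDerivAt (fun y : Fin N → ℝ => y ⬝ᵥ r)
      (LinearMap.toContinuousLinearMap (dotProductBilin ℝ ℝ r)) x := by
    have := (LinearMap.toContinuousLinearMap (dotProductBilin ℝ ℝ r)).hasFDerivAt (x := x)
    refine this.congr_of_eventuallyEq (Filter.Eventually.of_forall fun y => ?_)
    simp [dotProductBilin, dotProduct_comm]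
  refine ((h1.log h.ne').neg).congr_fderiv ?_
  ext v
  simp [dotProductBilin, lossGrad, dotProduct, div_eq_inv_mul, Finset.mul_sum, mul_assoc]

/-- A minimizer of `F` over `S`. When Ada-BARRONS is run with `0 < N < T` on nonnegative nonzero price
relative vectors, `S` is always a nonempty compact convex set on which `F` is continuous and strictly
convex, so that the minimizer exists and is unique. -/
def argmin {N : ℕ} (S : Set (Fin N → ℝ)) (F : (Fin N → ℝ) → ℝ) : Fin N → ℝ :=
  Classical.epsilon fun x => x ∈ S ∧ IsMinOn F S x

/-- The Bregman divergence `D_ψ(x, y) = ψ(x) - ψ(y) - ⟨∇ψ(y), x - y⟩`. -/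
def bregman {N : ℕ} (ψ : (Fin N → ℝ) → ℝ) (x y : Fin N → ℝ) : ℝ :=
  ψ x - ψ y - fderiv ℝ ψ y (x - y)

/-- The truncated simplex `{x ∈ Δ_N : x_i ≥ 1 / (N T) for all i}`. -/
def truncSimplex (N T : ℕ) : Set (Fin N → ℝ) :=
  {x | x ∈ stdSimplex ℝ (Fin N) ∧ ∀ i, 1 / ((N : ℝ) * T) ≤ x i}

/-- The matrix `A_t = N I + ∑_{s ≤ t} ∇_s ∇_sᵀ`, where `∇_s = ∇f_s(x_s)`. -/
def covMatrix {N : ℕ} (r x : ℕ → Fin N → ℝ) (t : ℕ) : Matrix (Fin N) (Fin N) ℝ :=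
  (N : ℝ) • (1 : Matrix (Fin N) (Fin N) ℝ) +
    ∑ s ∈ Finset.range (t + 1), Matrix.vecMulVec (lossGrad (r s) (x s)) (lossGrad (r s) (x s))

/-- The learning rate `η_{t,i} = η exp (max_{s ≤ t} log_T (1 / (N x_{s,i})))`. -/
def learningRate {N : ℕ} (T : ℕ) (η : ℝ) (x : ℕ → Fin N → ℝ) (t : ℕ) (i : Fin N) : ℝ :=
  η * Real.exp ((Finset.range (t + 1)).sup' Finset.nonempty_range_add_one
    fun s => Real.logb T (1 / (N * x s i)))

/-- The regularizer `ψ_t(y) = (β / 2) yᵀ A_t y + ∑ i, (1 / η_{t,i}) ln (1 / y_i)`. -/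
def regularizer {N : ℕ} (T : ℕ) (β η : ℝ) (r x : ℕ → Fin N → ℝ) (t : ℕ) (y : Fin N → ℝ) : ℝ :=
  β / 2 * (y ⬝ᵥ (covMatrix r x t *ᵥ y)) +
    ∑ i, 1 / learningRate T η x t i * Real.log (1 / y i)

/-- The function `y ↦ ⟨y, ∇_t⟩ + D_{ψ_t}(y, x_t)` that is minimized to obtain `x_{t+1}`. -/
def omdObjective {N : ℕ} (T : ℕ) (β η : ℝ) (r x : ℕ → Fin N → ℝ) (t : ℕ) (y : Fin N → ℝ) : ℝ :=
  y ⬝ᵥ lossGrad (r t) (x t) + bregman (regularizer T β η r x t) y (x t)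

/-- The plays of BARRONS with horizon parameter `T` and parameters `β, η` on the price relative vectors
`r`. The play `t + 1` depends on `r s` and on the plays `s` with `s ≤ t` only (the value `0` given
to the later plays inside the definition is never used, see `barrons_succ`). -/
def barrons {N : ℕ} (T : ℕ) (β η : ℝ) (r : ℕ → Fin N → ℝ) : ℕ → Fin N → ℝ
  | 0 => fun _ => 1 / (N : ℝ)
  | t + 1 => argmin (truncSimplex N T)
      (omdObjective T β η r (fun s => if _h : s ≤ t then barrons T β η r s else 0) t)
  decreasing_by omega

theorem omdObjective_congr {N : ℕ} (T : ℕ) (β η : ℝ) {r r' x x' : ℕ → Fin N → ℝ} {t : ℕ}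
    (hr : ∀ s ≤ t, r s = r' s) (hx : ∀ s ≤ t, x s = x' s) :
    omdObjective T β η r x t = omdObjective T β η r' x' t := by
  have hA : covMatrix r x t = covMatrix r' x' t := by
    unfold covMatrix
    congr 1
    refine Finset.sum_congr rfl fun s hs => ?_
    have hs' : s ≤ t := by simpa [Nat.lt_succ_iff] using hs
    rw [hr s hs', hx s hs']
  have hη : ∀ i, learningRate T η x t i = learningRate T η x' t i := by
    intro i
    unfold learningRate
    congr 2
    refine Finset.sup'_congr _ rfl fun s hs => ?_
    have hs' : s ≤ t := by simpa [Nat.lt_succ_iff] using hs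
    rw [hx s hs']
  have hψ : regularizer T β η r x t = regularizer T β η r' x' t := by
    funext y
    simp only [regularizer, hA, hη]
  funext y
  simp only [omdObjective, hψ, hr t le_rfl, hx t le_rfl]

theorem barrons_zero {N : ℕ} (T : ℕ) (β η : ℝ) (r : ℕ → Fin N → ℝ) :
    barrons T β η r 0 = fun _ => 1 / (N : ℝ) := by
  rw [barrons]

theorem barrons_succ {N : ℕ} (T : ℕ) (β η : ℝ) (r : ℕ → Fin N → ℝ) (t : ℕ) :
    barrons T β η r (t + 1) =
      argmin (truncSimplex N T) (omdObjective T β η r (barrons T β η r) t) := by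
  rw [barrons]
  congr 1
  exact omdObjective_congr T β η (fun _ _ => rfl) fun s hs => by simp [hs]

/-- `α_t(u) = min {1/2, min_{s ≤ t} 1 / (8 |(u - x_s)ᵀ ∇_s|)}`, where `1 / 0 = ∞`. -/
def alpha {N : ℕ} (r x : ℕ → Fin N → ℝ) (t : ℕ) (u : Fin N → ℝ) : ℝ≥0∞ :=
  min (1 / 2) (⨅ s ∈ Finset.range (t + 1),
    1 / ENNReal.ofReal (8 * |(u - x s) ⬝ᵥ lossGrad (r s) (x s)|))

/-- The regularized leader
`u_t = argmin_{u} ∑_{s ≤ t} f_s(u) + (1 / γ) ∑ i, ln (1 / u_i)` over the truncated simplex. -/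
def regLeader {N : ℕ} (T : ℕ) (γ : ℝ) (r : ℕ → Fin N → ℝ) (t : ℕ) : Fin N → ℝ :=
  argmin (truncSimplex N T) fun u =>
    (∑ s ∈ Finset.range (t + 1), loss (r s) u) + 1 / γ * ∑ i, Real.log (1 / u i)

/-- The parameter `η = 1 / (2048 N (ln T)²)` of Ada-BARRONS. -/
def adaEta (N T : ℕ) : ℝ := 1 / (2048 * N * Real.log T ^ 2)

/-- The parameter `γ = 1 / 25` of Ada-BARRONS. -/
def adaGamma : ℝ := 1 / 25

/-- The state of Ada-BARRONS before a round: the current value of `β`, the global index `start` of the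
first round of the current epoch, and the index `round` of the round within the current epoch;
the global index of the round is `start + round`. -/
structure AdaState where
  /-- current `β` -/
  β : ℝ
  /-- global index of the first round of the current epoch -/
  start : ℕ
  /-- index within the current epoch -/
  round : ℕ

/-- The price relative vectors of the current epoch, with the time index reset at its start. -/
def AdaState.epochPrices {N : ℕ} (S : AdaState) (r : ℕ → Fin N → ℝ) : ℕ → Fin N → ℝ :=
  fun s => r (S.start + s)

/-- The plays in the current epoch: BARRONS run on the data of the epoch only. -/
def AdaState.epochPlays {N : ℕ} (S : AdaState) (T : ℕ) (r : ℕ → Fin N → ℝ) : ℕ → Fin N → ℝ :=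
  barrons T S.β (adaEta N T) (S.epochPrices r)

/-- The restart condition `β > α_t(u_t)`, checked at the end of the round. -/
def AdaState.Restarts {N : ℕ} (S : AdaState) (T : ℕ) (r : ℕ → Fin N → ℝ) : Prop :=
  alpha (S.epochPrices r) (S.epochPlays T r) S.round
    (regLeader T adaGamma (S.epochPrices r) S.round) < ENNReal.ofReal S.β

open Classical in
/-- The state of Ada-BARRONS before round `t`. -/
def adaState {N : ℕ} (T : ℕ) (r : ℕ → Fin N → ℝ) : ℕ → AdaState
  | 0 => ⟨1 / 2, 0, 0⟩
  | t + 1 =>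
    let S := adaState T r t
    if S.Restarts T r then ⟨S.β / 2, S.start + S.round + 1, 0⟩
    else ⟨S.β, S.start, S.round + 1⟩

/-- The play of Ada-BARRONS in round `t`. -/
def adaBarrons {N : ℕ} (T : ℕ) (r : ℕ → Fin N → ℝ) (t : ℕ) : Fin N → ℝ :=
  (adaState T r t).epochPlays T r (adaState T r t).round

end AdaBarrons

end

/-!
For positive portfolios `x_s` and `w`, the loss difference `f_s(x_s) - f_s(w)` is `ln ρ_s`, where
`ρ_s = ⟨w, r_s⟩ / ⟨x_s, r_s⟩`. As long as `β ρ_s ≤ 1`, it is at most the linearized loss difference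
minus `β / 2` times its square. Mirror descent with the quadratic part of `ψ_t` turns these squares
into the logarithm of a determinant, at a cost of `O(N ln T / β)`; the logarithmic barrier costs
`O(N ln T / η)`; and its increasing learning rates earn a negative term of order
`N ln T · max_s ρ_s`.

Within an epoch, the last regularized leader that did not cause a restart is a near-optimal
comparator with `β ρ_s ≤ 1` in all rounds, so the regret is at most `O(N² (ln T)³) + 3 N ln T / β`.
If the epoch ends with a restart, then some near-optimal `w` has `β ρ_s ≤ 1` in all rounds but the
last one and `8 max (1, ρ_s) ≥ 1 / β` in some round, and the negative term improves the bound to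
`O(N² (ln T)³) - 3 N ln T / β`. As `1 / β` doubles from epoch to epoch, the negative terms of the
completed epochs pay for the term `3 N ln T / β` of the last one. Finally `1 / β = O(N T)`, so there
are `O(ln T)` epochs, and an arbitrary comparator enters the truncated simplex at a cost of at most
`2` when it is mixed with the uniform portfolio with weight `1 / T`.
-/

namespace AdaBarrons

/-! ### Scalar inequalities -/

section Scalar

/-- The Itakura–Saito divergence `z - 1 - ln z` of `z` from `1`: the logarithmic barrier
`ln (1 / ·)` contributes `itakuraSaito (w / x)` to the Bregman divergence of `w` from `x`. -/
noncomputable def itakuraSaito (z : ℝ) : ℝ := z - 1 - Real.log z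

theorem itakuraSaito_nonneg {z : ℝ} (hz : 0 < z) : 0 ≤ itakuraSaito z :=
  sub_nonneg.2 (Real.log_le_sub_one_of_pos hz)

theorem half_le_itakuraSaito {z : ℝ} (hz : 6 ≤ z) : z / 2 ≤ itakuraSaito z := by
  have hlog : Real.log z = 2 * Real.log 2 + Real.log (z / 4) := by
    rw [Real.log_div (by linarith) (by norm_num), show (4 : ℝ) = 2 ^ 2 by norm_num, Real.log_pow]
    norm_num
  have := Real.log_le_sub_one_of_pos (show 0 < z / 4 by linarith)
  rw [itakuraSaito, hlog]
  linarith [Real.log_two_lt_d9]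

theorem neg_log_one_sub_le {a : ℝ} (ha : 0 ≤ a) (ha' : a ≤ 1 / 2) : -Real.log (1 - a) ≤ 2 * a := by
  have hpos : 0 < 1 - a := by linarith
  have hinv : (1 - a)⁻¹ ≤ 1 + 2 * a := by
    rw [inv_le_iff_one_le_mul₀ hpos]
    nlinarith
  linarith [Real.one_sub_inv_le_log_of_pos hpos]

-- For `1 ≤ m` this is `ln m ≤ sinh (ln m)`; for `m ≤ 1` it is `ln v ≤ v - 1` at `v = √m`.
theorem log_le_sub_sq {β m : ℝ} (hm : 0 < m) (hβ : β ≤ 1 / 2) (hβm : β * m ≤ 1) :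
    Real.log m ≤ (m - 1) - β / 2 * (m - 1) ^ 2 := by
  rcases le_total 1 m with h1m | hm1
  · have hsinh := Real.self_le_sinh_iff.2 (Real.log_nonneg h1m)
    rw [Real.sinh_eq, Real.exp_neg, Real.exp_log hm] at hsinh
    have hβ' : β ≤ 1 / m := (le_div_iff₀ hm).2 hβm
    calc Real.log m ≤ (m - m⁻¹) / 2 := hsinh
      _ = (m - 1) - 1 / m / 2 * (m - 1) ^ 2 := by field_simp; ring
      _ ≤ (m - 1) - β / 2 * (m - 1) ^ 2 := by gcongr
  · obtain ⟨v, hv, rfl⟩ : ∃ v : ℝ, 0 < v ∧ m = v ^ 2 :=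
      ⟨√m, Real.sqrt_pos.2 hm, (Real.sq_sqrt hm.le).symm⟩
    have hv1 : v ≤ 1 := by nlinarith
    calc Real.log (v ^ 2) = 2 * Real.log v := by rw [Real.log_pow]; norm_num
      _ ≤ 2 * (v - 1) := by linarith [Real.log_le_sub_one_of_pos hv]
      _ ≤ (v ^ 2 - 1) - 1 / 4 * (v ^ 2 - 1) ^ 2 := by
        nlinarith [mul_nonneg (sq_nonneg (v - 1)) (show 0 ≤ 4 - (v + 1) ^ 2 by nlinarith)]
      _ ≤ (v ^ 2 - 1) - β / 2 * (v ^ 2 - 1) ^ 2 :=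
        sub_le_sub_left (mul_le_mul_of_nonneg_right (by linarith) (sq_nonneg _)) _

theorem exp_neg_sub_exp_neg_le {g l : ℝ} (hgl : g ≤ l) (hl : l ≤ 1) :
    Real.exp (-l) - Real.exp (-g) ≤ -((l - g) * Real.exp (-1)) := by
  have hgrow : Real.exp (-l) * (l - g + 1) ≤ Real.exp (-g) := by
    rw [show -g = -l + (l - g) by ring, Real.exp_add]
    gcongr
    exact Real.add_one_le_exp _
  have hl' : (l - g) * Real.exp (-1) ≤ (l - g) * Real.exp (-l) := by
    gcongr
  linarith

theorem max_sub_max_mul_exp_neg_le {δ y : ℝ} (hδ : 0 ≤ δ) (hy : 0 < y) :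
    max y 6 - max (y * Real.exp (-δ)) 6 ≤ 2 * δ * itakuraSaito y := by
  rcases le_total y 6 with hy6 | hy6
  · rw [max_eq_right hy6]
    have := mul_nonneg hδ (itakuraSaito_nonneg hy)
    linarith [le_max_right (y * Real.exp (-δ)) 6]
  · calc max y 6 - max (y * Real.exp (-δ)) 6 ≤ y - y * Real.exp (-δ) := by
          rw [max_eq_left hy6]
          gcongr
          exact le_max_left _ _
      _ = y * (1 - Real.exp (-δ)) := by ring
      _ ≤ y * δ := by gcongr; linarith [Real.one_sub_le_exp_neg δ]
      _ = 2 * δ * (y / 2) := by ring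
      _ ≤ 2 * δ * itakuraSaito y := by gcongr; exact half_le_itakuraSaito hy6

-- The increasing learning rates of BARRONS earn back a multiple of the growth of `K T ^ g`,
-- the bound on the wealth ratio of the comparator over the plays.
theorem exp_neg_sub_mul_itakuraSaito_le {T K g l : ℝ} (hT : 1 < T) (hK : 0 < K) (hl : l ≤ 1) :
    (Real.exp (-max g l) - Real.exp (-g)) * itakuraSaito (K * T ^ l) ≤
      -(Real.exp (-1) / (2 * Real.log T)) *
        (max (K * T ^ max g l) 6 - max (K * T ^ g) 6) := by
  rcases le_total l g with hlg | hgl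
  · simp [max_eq_left hlg]
  have hT0 : 0 < T := by linarith
  have hL : 0 < Real.log T := Real.log_pos hT
  have hy : 0 < K * T ^ l := by positivity
  have hδ : 0 ≤ (l - g) * Real.log T := mul_nonneg (sub_nonneg.2 hgl) hL.le
  have hg : K * T ^ g = K * T ^ l * Real.exp (-((l - g) * Real.log T)) := by
    rw [Real.rpow_def_of_pos hT0, Real.rpow_def_of_pos hT0, mul_assoc, ← Real.exp_add]
    ring_nf
  rw [max_eq_right hgl, hg]
  calc (Real.exp (-l) - Real.exp (-g)) * itakuraSaito (K * T ^ l)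
      ≤ -((l - g) * Real.exp (-1)) * itakuraSaito (K * T ^ l) :=
        mul_le_mul_of_nonneg_right (exp_neg_sub_exp_neg_le hgl hl) (itakuraSaito_nonneg hy)
    _ = -(Real.exp (-1) / (2 * Real.log T)) *
          (2 * ((l - g) * Real.log T) * itakuraSaito (K * T ^ l)) := by field_simp
    _ ≤ _ := mul_le_mul_of_nonpos_left (max_sub_max_mul_exp_neg_le hδ hy)
        (neg_nonpos.2 (by positivity))

end Scalar

/-! ### Positive definite matrices -/

section Matrix

variable {n : Type*}

theorem posSemidef_vecMulVec [Finite n] (g : n → ℝ) : (Matrix.vecMulVec g g).PosSemidef := by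
  simpa using Matrix.posSemidef_vecMulVec_self_star g

variable [Fintype n] {A : Matrix n n ℝ}

theorem dotProduct_mulVec_comm (hA : A.IsSymm) (u v : n → ℝ) : u ⬝ᵥ A *ᵥ v = v ⬝ᵥ A *ᵥ u := by
  rw [← Matrix.dotProduct_transpose_mulVec, hA.eq]

theorem dotProduct_vecMulVec_mulVec (g d : n → ℝ) :
    d ⬝ᵥ Matrix.vecMulVec g g *ᵥ d = (g ⬝ᵥ d) ^ 2 := by
  rw [Matrix.vecMulVec_mulVec]
  simp [dotProduct_comm d g, sq]

theorem det_le_trace_pow_card [DecidableEq n] (hA : A.PosSemidef) :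
    A.det ≤ A.trace ^ Fintype.card n := by
  have hnonneg := hA.eigenvalues_nonneg
  have htrace : A.trace = ∑ i, hA.isHermitian.eigenvalues i := by
    simpa using hA.isHermitian.trace_eq_sum_eigenvalues
  calc A.det = ∏ i, hA.isHermitian.eigenvalues i := by
        simpa using hA.isHermitian.det_eq_prod_eigenvalues
    _ ≤ ∏ _i : n, A.trace := Finset.prod_le_prod (fun i _ => hnonneg i) fun i _ =>
        htrace ▸ Finset.single_le_sum (fun j _ => hnonneg j) (Finset.mem_univ i)
    _ = A.trace ^ Fintype.card n := by rw [Finset.prod_const, Finset.card_univ]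

variable [DecidableEq n]

-- Expand the form of `A` at `β d - A⁻¹ g`, which is nonnegative.
theorem dotProduct_le_inv_form_add_form (hA : A.PosDef) {β : ℝ} (hβ : 0 < β) (g d : n → ℝ) :
    g ⬝ᵥ d ≤ 1 / (2 * β) * (g ⬝ᵥ A⁻¹ *ᵥ g) + β / 2 * (d ⬝ᵥ A *ᵥ d) := by
  have hsymm : A.IsSymm := Matrix.isHermitian_iff_isSymm.1 hA.isHermitian
  set p := A⁻¹ *ᵥ g with hp
  have hAp : A *ᵥ p = g := by
    rw [hp, Matrix.mulVec_mulVec, Matrix.mul_nonsing_inv _ hA.det_pos.ne'.isUnit,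
      Matrix.one_mulVec]
  have hsq : 0 ≤ β * (β * (d ⬝ᵥ A *ᵥ d) - g ⬝ᵥ d) - (β * (g ⬝ᵥ d) - g ⬝ᵥ p) := by
    have h := hA.posSemidef.dotProduct_mulVec_nonneg (β • d - p)
    simp only [star_trivial, Matrix.mulVec_sub, Matrix.mulVec_smul, hAp, sub_dotProduct,
      dotProduct_sub, smul_dotProduct, dotProduct_smul, smul_eq_mul] at h
    rwa [dotProduct_mulVec_comm hsymm p d, hAp, dotProduct_comm d g, dotProduct_comm p g] at h
  have hscale : 1 / (2 * β) * (g ⬝ᵥ p) + β / 2 * (d ⬝ᵥ A *ᵥ d) - g ⬝ᵥ d =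
      1 / (2 * β) * (β * (β * (d ⬝ᵥ A *ᵥ d) - g ⬝ᵥ d) - (β * (g ⬝ᵥ d) - g ⬝ᵥ p)) := by
    field_simp
    ring
  have := mul_nonneg (show 0 ≤ 1 / (2 * β) by positivity) hsq
  linarith

theorem det_eq_det_add_vecMulVec_mul (hA : A.PosDef) (g : n → ℝ) :
    A.det = (A + Matrix.vecMulVec g g).det *
      (1 - g ⬝ᵥ (A + Matrix.vecMulVec g g)⁻¹ *ᵥ g) := by
  have hB : (A + Matrix.vecMulVec g g).PosDef := hA.add_posSemidef (posSemidef_vecMulVec g)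
  set B := A + Matrix.vecMulVec g g with hBdef
  have hdown : B + Matrix.replicateCol Unit (-g) * Matrix.replicateRow Unit g = A := by
    rw [← Matrix.vecMulVec_eq, hBdef, Matrix.neg_vecMulVec, add_neg_cancel_right]
  have hscalar : (1 + Matrix.replicateRow Unit g * B⁻¹ * Matrix.replicateCol Unit (-g)).det =
      1 - g ⬝ᵥ B⁻¹ *ᵥ g := by
    rw [Matrix.det_unique, Matrix.mul_assoc, ← Matrix.replicateCol_mulVec]
    simp [Matrix.mul_apply, Matrix.mulVec_neg, dotProduct, sub_eq_add_neg]
  rw [← hscalar, ← Matrix.det_add_replicateCol_mul_replicateRow hB.det_pos.ne'.isUnit, hdown]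

theorem dotProduct_inv_mulVec_le_log_det (hA : A.PosDef) (g : n → ℝ) :
    g ⬝ᵥ (A + Matrix.vecMulVec g g)⁻¹ *ᵥ g ≤
      Real.log (A + Matrix.vecMulVec g g).det - Real.log A.det := by
  have hdetB := (hA.add_posSemidef (posSemidef_vecMulVec g)).det_pos
  have hdet := det_eq_det_add_vecMulVec_mul hA g
  have hfactor : 0 < 1 - g ⬝ᵥ (A + Matrix.vecMulVec g g)⁻¹ *ᵥ g :=
    pos_of_mul_pos_right (hdet ▸ hA.det_pos) hdetB.le
  have hlog := Real.log_mul hdetB.ne' hfactor.ne'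
  rw [← hdet] at hlog
  linarith [Real.log_le_sub_one_of_pos hfactor]

end Matrix

/-! ### Mirror descent -/

section MirrorDescent

variable {N : ℕ} {S : Set (Fin N → ℝ)} {ψ : (Fin N → ℝ) → ℝ}

theorem argmin_spec {F : (Fin N → ℝ) → ℝ} (hS : IsCompact S) (hne : S.Nonempty)
    (hF : ContinuousOn F S) : argmin S F ∈ S ∧ IsMinOn F S (argmin S F) :=
  Classical.epsilon_spec (p := fun x => x ∈ S ∧ IsMinOn F S x) (hS.exists_isMinOn hne hF)

theorem bregman_three_point (ψ : (Fin N → ℝ) → ℝ) (u x y : Fin N → ℝ) :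
    fderiv ℝ ψ y (u - y) - fderiv ℝ ψ x (u - y) =
      bregman ψ u x - bregman ψ u y - bregman ψ y x := by
  simp only [bregman, map_sub]
  ring

theorem hasFDerivAt_dotProduct_add_bregman {x y : Fin N → ℝ} (hψ : DifferentiableAt ℝ ψ y)
    (g : Fin N → ℝ) :
    HasFDerivAt (fun z => z ⬝ᵥ g + bregman ψ z x)
      (LinearMap.toContinuousLinearMap (dotProductBilin ℝ ℝ g) +
        (fderiv ℝ ψ y - fderiv ℝ ψ x)) y := by
  have hlin : HasFDerivAt (fun z : Fin N → ℝ => z ⬝ᵥ g)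
      (LinearMap.toContinuousLinearMap (dotProductBilin ℝ ℝ g)) y := by
    simpa [dotProductBilin, dotProduct_comm] using
      (LinearMap.toContinuousLinearMap (dotProductBilin ℝ ℝ g)).hasFDerivAt (x := y)
  exact hlin.add ((hψ.hasFDerivAt.sub_const (ψ x)).sub
    ((fderiv ℝ ψ x).hasFDerivAt.comp y ((hasFDerivAt_id y).sub_const x)))

theorem dotProduct_sub_le_bregman (hS : Convex ℝ S) {g x y u : Fin N → ℝ}
    (hψ : DifferentiableAt ℝ ψ y) (hy : y ∈ S) (hu : u ∈ S)
    (hmin : IsMinOn (fun z => z ⬝ᵥ g + bregman ψ z x) S y) :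
    g ⬝ᵥ (y - u) ≤ bregman ψ u x - bregman ψ u y - bregman ψ y x := by
  have hfirst := hmin.localize.hasFDerivWithinAt_nonneg
    (hasFDerivAt_dotProduct_add_bregman hψ g).hasFDerivWithinAt
    (sub_mem_posTangentConeAt_of_segment_subset (hS.segment_subset hy hu))
  have hfirst' : 0 ≤ g ⬝ᵥ (u - y) + (fderiv ℝ ψ y (u - y) - fderiv ℝ ψ x (u - y)) := by
    simpa [dotProductBilin] using hfirst
  rw [bregman_three_point] at hfirst'
  rw [← neg_sub u y, dotProduct_neg]
  linarith

end MirrorDescent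

/-! ### Quadratic forms with a logarithmic barrier -/

section QuadLog

variable {N : ℕ} {β : ℝ} {A : Matrix (Fin N) (Fin N) ℝ} {c u x y : Fin N → ℝ}

/-- The regularizer `(β / 2) yᵀ A y + ∑ i, c i ln (1 / y i)`; the regularizers of BARRONS have
this form. -/
noncomputable def quadLog (β : ℝ) (A : Matrix (Fin N) (Fin N) ℝ) (c y : Fin N → ℝ) : ℝ :=
  β / 2 * (y ⬝ᵥ A *ᵥ y) + ∑ i, c i * Real.log (1 / y i)

/-- The Bregman divergence of `quadLog` on the positive orthant, in closed form. -/
noncomputable def quadLogDiv (β : ℝ) (A : Matrix (Fin N) (Fin N) ℝ) (c u x : Fin N → ℝ) : ℝ :=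
  β / 2 * ((u - x) ⬝ᵥ A *ᵥ (u - x)) + ∑ i, c i * itakuraSaito (u i / x i)

theorem differentiableAt_quadLog (β : ℝ) (A : Matrix (Fin N) (Fin N) ℝ) (c : Fin N → ℝ)
    (hy : ∀ i, 0 < y i) : DifferentiableAt ℝ (quadLog β A c) y := by
  unfold quadLog
  simp only [dotProduct, Matrix.mulVec, one_div, Real.log_inv]
  refine DifferentiableAt.add (by fun_prop) (DifferentiableAt.fun_sum fun i _ => ?_)
  have hcoord : DifferentiableAt ℝ (fun z : Fin N → ℝ => z i) y := by fun_prop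
  exact ((hcoord.log (hy i).ne').neg).const_mul _

theorem hasLineDerivAt_quadForm (hA : A.IsSymm) (y v : Fin N → ℝ) :
    HasLineDerivAt ℝ (fun z => z ⬝ᵥ A *ᵥ z) (2 * (v ⬝ᵥ A *ᵥ y)) y v := by
  have hline : ∀ t : ℝ, (y + t • v) ⬝ᵥ A *ᵥ (y + t • v) =
      y ⬝ᵥ A *ᵥ y + t * (2 * (v ⬝ᵥ A *ᵥ y)) + t ^ 2 * (v ⬝ᵥ A *ᵥ v) := by
    intro t
    simp only [Matrix.mulVec_add, Matrix.mulVec_smul, add_dotProduct, dotProduct_add,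
      smul_dotProduct, dotProduct_smul, smul_eq_mul]
    rw [dotProduct_mulVec_comm hA y v]
    ring
  simp only [HasLineDerivAt, hline]
  have hpoly := (((hasDerivAt_id (0 : ℝ)).mul_const (2 * (v ⬝ᵥ A *ᵥ y))).const_add
    (y ⬝ᵥ A *ᵥ y)).fun_add (((hasDerivAt_id (0 : ℝ)).pow 2).mul_const (v ⬝ᵥ A *ᵥ v))
  simpa using hpoly

theorem hasLineDerivAt_logBarrier (c : Fin N → ℝ) (hy : ∀ i, 0 < y i) (v : Fin N → ℝ) :
    HasLineDerivAt ℝ (fun z => ∑ i, c i * Real.log (1 / z i)) (-∑ i, c i * (v i / y i)) y v := by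
  rw [← Finset.sum_neg_distrib]
  refine HasDerivAt.fun_sum fun i _ => ?_
  have hcoord : HasDerivAt (fun t : ℝ => y i + t * v i) (v i) 0 := by
    simpa using ((hasDerivAt_id (0 : ℝ)).mul_const (v i)).const_add (y i)
  simpa using ((hcoord.log (by simpa using (hy i).ne')).neg).const_mul (c i)

theorem fderiv_quadLog (hA : A.IsSymm) (hy : ∀ i, 0 < y i) (v : Fin N → ℝ) :
    fderiv ℝ (quadLog β A c) y v = β * (v ⬝ᵥ A *ᵥ y) - ∑ i, c i * (v i / y i) := by
  rw [← (differentiableAt_quadLog β A c hy).lineDeriv_eq_fderiv]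
  refine HasLineDerivAt.lineDeriv (HasDerivAt.congr_deriv (HasDerivAt.add
    (HasDerivAt.const_mul (β / 2) (hasLineDerivAt_quadForm hA y v))
    (hasLineDerivAt_logBarrier c hy v)) ?_)
  ring

theorem bregman_quadLog (hA : A.IsSymm) (hu : ∀ i, 0 < u i) (hx : ∀ i, 0 < x i) :
    bregman (quadLog β A c) u x = quadLogDiv β A c u x := by
  have hbarrier : ∑ i, c i * itakuraSaito (u i / x i) =
      ∑ i, c i * Real.log (1 / u i) - ∑ i, c i * Real.log (1 / x i) +
        ∑ i, c i * ((u - x) i / x i) := by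
    rw [← Finset.sum_sub_distrib, ← Finset.sum_add_distrib]
    refine Finset.sum_congr rfl fun i _ => ?_
    rw [itakuraSaito, Real.log_div (hu i).ne' (hx i).ne', one_div, one_div, Real.log_inv,
      Real.log_inv, Pi.sub_apply, sub_div, div_self (hx i).ne']
    ring
  rw [bregman, fderiv_quadLog hA hx, quadLogDiv, hbarrier, quadLog, quadLog]
  simp only [Matrix.mulVec_sub, sub_dotProduct, dotProduct_sub]
  rw [dotProduct_mulVec_comm hA x u]
  ring

theorem form_le_quadLogDiv (hc : ∀ i, 0 ≤ c i) (hu : ∀ i, 0 < u i) (hx : ∀ i, 0 < x i) :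
    β / 2 * ((u - x) ⬝ᵥ A *ᵥ (u - x)) ≤ quadLogDiv β A c u x :=
  le_add_of_nonneg_right <| Finset.sum_nonneg fun i _ =>
    mul_nonneg (hc i) (itakuraSaito_nonneg (div_pos (hu i) (hx i)))

theorem quadLogDiv_nonneg (hβ : 0 ≤ β) (hA : A.PosSemidef) (hc : ∀ i, 0 ≤ c i)
    (hu : ∀ i, 0 < u i) (hx : ∀ i, 0 < x i) : 0 ≤ quadLogDiv β A c u x :=
  (mul_nonneg (by positivity) (by simpa using hA.dotProduct_mulVec_nonneg (u - x))).trans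
    (form_le_quadLogDiv hc hu hx)

theorem quadLogDiv_add_vecMulVec (β : ℝ) (A : Matrix (Fin N) (Fin N) ℝ) (c g u x : Fin N → ℝ) :
    quadLogDiv β (A + Matrix.vecMulVec g g) c u x =
      quadLogDiv β A c u x + β / 2 * (g ⬝ᵥ (x - u)) ^ 2 := by
  rw [quadLogDiv, quadLogDiv, Matrix.add_mulVec, dotProduct_add, dotProduct_vecMulVec_mulVec,
    ← neg_sub u x, dotProduct_neg, neg_sq]
  ring

theorem quadLogDiv_sub_quadLogDiv (β : ℝ) (A : Matrix (Fin N) (Fin N) ℝ) (c c' u x : Fin N → ℝ) :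
    quadLogDiv β A c' u x - quadLogDiv β A c u x =
      ∑ i, (c' i - c i) * itakuraSaito (u i / x i) := by
  simp only [quadLogDiv, sub_mul, Finset.sum_sub_distrib]
  ring

-- The Bregman term `D(y, x)` pays for moving from `x` to `y` by Young's inequality.
theorem dotProduct_sub_le_quadLogDiv {S : Set (Fin N → ℝ)} (hS : Convex ℝ S)
    (hpos : ∀ z ∈ S, ∀ i, 0 < z i) (hβ : 0 < β) (hA : A.PosDef) (hc : ∀ i, 0 ≤ c i)
    {g : Fin N → ℝ} (hx : x ∈ S) (hy : y ∈ S) (hu : u ∈ S)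
    (hmin : IsMinOn (fun z => z ⬝ᵥ g + bregman (quadLog β A c) z x) S y) :
    g ⬝ᵥ (x - u) ≤ 1 / (2 * β) * (g ⬝ᵥ A⁻¹ *ᵥ g) +
      quadLogDiv β A c u x - quadLogDiv β A c u y := by
  have hsymm : A.IsSymm := Matrix.isHermitian_iff_isSymm.1 hA.isHermitian
  have hmove := dotProduct_sub_le_bregman hS (differentiableAt_quadLog β A c (hpos y hy)) hy hu
    hmin
  rw [bregman_quadLog hsymm (hpos u hu) (hpos x hx), bregman_quadLog hsymm (hpos u hu) (hpos y hy),
    bregman_quadLog hsymm (hpos y hy) (hpos x hx)] at hmove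
  have hyoung := dotProduct_le_inv_form_add_form hA hβ g (x - y)
  rw [← neg_sub y x, Matrix.mulVec_neg, neg_dotProduct, dotProduct_neg, dotProduct_neg,
    neg_neg] at hyoung
  have hform := form_le_quadLogDiv (β := β) (A := A) hc (hpos y hy) (hpos x hx)
  simp only [dotProduct_sub] at hmove hyoung ⊢
  linarith

end QuadLog

/-! ### The truncated simplex -/

section TruncSimplex

variable {N T : ℕ} {x y : Fin N → ℝ}

theorem isCompact_truncSimplex (N T : ℕ) : IsCompact (truncSimplex N T) := by
  have hinter : truncSimplex N T = stdSimplex ℝ (Fin N) ∩ Set.Ici fun _ => 1 / ((N : ℝ) * T) :=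
    rfl
  exact hinter ▸ (isCompact_stdSimplex ℝ (Fin N)).inter_right isClosed_Ici

theorem convex_truncSimplex (N T : ℕ) : Convex ℝ (truncSimplex N T) :=
  (convex_stdSimplex ℝ (Fin N)).inter (convex_Ici fun _ => 1 / ((N : ℝ) * T))

theorem uniform_mem_truncSimplex (hN : 0 < N) (hT : 0 < T) :
    (fun _ => 1 / (N : ℝ)) ∈ truncSimplex N T := by
  have hN' : (0 : ℝ) < N := by exact_mod_cast hN
  have hT' : (1 : ℝ) ≤ T := by exact_mod_cast hT
  refine ⟨⟨fun _ => by positivity, by simp [hN'.ne']⟩, fun _ => ?_⟩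
  exact one_div_le_one_div_of_le hN' (by nlinarith)

theorem truncSimplex_le_one (hx : x ∈ truncSimplex N T) (i : Fin N) : x i ≤ 1 :=
  (mem_Icc_of_mem_stdSimplex hx.1 i).2

theorem truncSimplex_pos (hT : 0 < T) (hx : x ∈ truncSimplex N T) (i : Fin N) : 0 < x i := by
  have := i.pos
  exact lt_of_lt_of_le (by positivity) (hx.2 i)

theorem one_div_le_of_mem_truncSimplex (hT : 0 < T) (hx : x ∈ truncSimplex N T) (i : Fin N) :
    1 / x i ≤ N * T := by
  have := i.pos
  rw [one_div_le (truncSimplex_pos hT hx i) (by positivity)]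
  exact hx.2 i

theorem div_le_of_mem_truncSimplex (hT : 0 < T) (hx : x ∈ truncSimplex N T) {i : Fin N}
    (hy : y i ≤ 1) : y i / x i ≤ N * T :=
  (div_le_div_of_nonneg_right hy (truncSimplex_pos hT hx i).le).trans
    (one_div_le_of_mem_truncSimplex hT hx i)

end TruncSimplex

/-! ### Losses and wealth ratios -/

section Loss

variable {ι : Type*} [Fintype ι] {N T : ℕ}

theorem dotProduct_pos {r x : ι → ℝ} (hx : ∀ i, 0 < x i) (hr : 0 < r) : 0 < x ⬝ᵥ r := by
  obtain ⟨hr0, i, hi⟩ := Pi.lt_def.1 hr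
  exact Finset.sum_pos' (fun j _ => mul_nonneg (hx j).le (hr0 j))
    ⟨i, Finset.mem_univ i, mul_pos (hx i) hi⟩

/-- The ratio of the wealth factors of the portfolios `w` and `x` in a round with price relatives
`r`, through which the loss and its linearization are expressed. -/
noncomputable def wealthRatio (r x w : ι → ℝ) : ℝ := w ⬝ᵥ r / (x ⬝ᵥ r)

theorem wealthRatio_pos {r x w : ι → ℝ} (hx : ∀ i, 0 < x i) (hw : ∀ i, 0 < w i) (hr : 0 < r) :
    0 < wealthRatio r x w :=
  div_pos (dotProduct_pos hw hr) (dotProduct_pos hx hr)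

theorem exists_wealthRatio_le_div {r x : ι → ℝ} (hx : ∀ i, 0 < x i) (hr : 0 < r) (w : ι → ℝ) :
    ∃ i, wealthRatio r x w ≤ w i / x i := by
  by_contra! hlt
  have hpos : 0 < (fun i => wealthRatio r x w * x i - w i) ⬝ᵥ r :=
    dotProduct_pos (fun i => sub_pos.2 ((div_lt_iff₀ (hx i)).1 (hlt i))) hr
  have hzero : (fun i => wealthRatio r x w * x i - w i) ⬝ᵥ r = 0 := by
    rw [show (fun i => wealthRatio r x w * x i - w i) = wealthRatio r x w • x - w from rfl,
      sub_dotProduct, smul_dotProduct, smul_eq_mul, wealthRatio,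
      div_mul_cancel₀ _ (dotProduct_pos hx hr).ne', sub_self]
  exact hpos.ne' hzero

theorem wealthRatio_le_of_mem_truncSimplex (hT : 0 < T) {r x w : Fin N → ℝ} (hr : 0 < r)
    (hx : x ∈ truncSimplex N T) (hw : ∀ i, w i ≤ 1) : wealthRatio r x w ≤ N * T := by
  obtain ⟨i, hi⟩ := exists_wealthRatio_le_div (truncSimplex_pos hT hx) hr w
  exact hi.trans (div_le_of_mem_truncSimplex hT hx (hw i))

theorem loss_sub_loss {r x w : Fin N → ℝ} (hx : 0 < x ⬝ᵥ r) (hw : 0 < w ⬝ᵥ r) :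
    loss r x - loss r w = Real.log (wealthRatio r x w) := by
  rw [loss, loss, wealthRatio, Real.log_div hw.ne' hx.ne']
  ring

theorem lossGrad_dotProduct (r x w : Fin N → ℝ) : lossGrad r x ⬝ᵥ w = -wealthRatio r x w := by
  have hscale : lossGrad r x = -((x ⬝ᵥ r)⁻¹ • r) := by
    ext i
    simp [lossGrad, div_eq_inv_mul]
  rw [hscale, neg_dotProduct, smul_dotProduct, smul_eq_mul, ← div_eq_inv_mul, dotProduct_comm,
    wealthRatio]

theorem lossGrad_dotProduct_sub {r x : Fin N → ℝ} (hx : 0 < x ⬝ᵥ r) (w : Fin N → ℝ) :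
    lossGrad r x ⬝ᵥ (x - w) = wealthRatio r x w - 1 := by
  rw [dotProduct_sub, lossGrad_dotProduct, lossGrad_dotProduct, wealthRatio, div_self hx.ne']
  ring

theorem loss_sub_loss_le {r x w : Fin N → ℝ} {β : ℝ} (hβ : β ≤ 1 / 2) (hx : 0 < x ⬝ᵥ r)
    (hw : 0 < w ⬝ᵥ r) (hcurv : β * wealthRatio r x w ≤ 1) :
    loss r x - loss r w ≤
      lossGrad r x ⬝ᵥ (x - w) - β / 2 * (lossGrad r x ⬝ᵥ (x - w)) ^ 2 := by
  rw [loss_sub_loss hx hw, lossGrad_dotProduct_sub hx]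
  exact log_le_sub_sq (div_pos hw hx) hβ hcurv

theorem abs_lossGrad_le (hT : 0 < T) {r x : Fin N → ℝ} (hx : x ∈ truncSimplex N T) (hr : 0 < r)
    (i : Fin N) : |lossGrad r x i| ≤ N * T := by
  have hsingle : lossGrad r x i = -wealthRatio r x (Pi.single i 1) := by
    rw [← lossGrad_dotProduct, dotProduct_single_one]
  have hnonneg : 0 ≤ wealthRatio r x (Pi.single i 1) := by
    rw [wealthRatio, single_one_dotProduct]
    exact div_nonneg (hr.le i) (dotProduct_pos (truncSimplex_pos hT hx) hr).le
  rw [hsingle, abs_neg, abs_of_nonneg hnonneg]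
  refine wealthRatio_le_of_mem_truncSimplex hT hr hx fun j => ?_
  rw [Pi.single_apply]
  split_ifs <;> norm_num

end Loss

/-! ### Gradient covariances -/

section Covariance

variable {N T : ℕ} {r x : ℕ → Fin N → ℝ} {n : ℕ}

/-- The matrix `N I + ∑_{s < n} ∇_s ∇_sᵀ` of the first `n` rounds, so that
`covMatrix r x t = covBefore r x (t + 1)`. -/
noncomputable def covBefore (r x : ℕ → Fin N → ℝ) (n : ℕ) : Matrix (Fin N) (Fin N) ℝ :=
  (N : ℝ) • (1 : Matrix (Fin N) (Fin N) ℝ) +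
    ∑ s ∈ Finset.range n, Matrix.vecMulVec (lossGrad (r s) (x s)) (lossGrad (r s) (x s))

theorem covBefore_zero (r x : ℕ → Fin N → ℝ) : covBefore r x 0 = (N : ℝ) • 1 := by
  simp [covBefore]

theorem covBefore_succ (r x : ℕ → Fin N → ℝ) (n : ℕ) :
    covBefore r x (n + 1) = covBefore r x n +
      Matrix.vecMulVec (lossGrad (r n) (x n)) (lossGrad (r n) (x n)) := by
  rw [covBefore, covBefore, Finset.sum_range_succ, add_assoc]

theorem covBefore_posDef (hN : 0 < N) (r x : ℕ → Fin N → ℝ) (n : ℕ) : (covBefore r x n).PosDef :=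
  (Matrix.PosDef.one.smul (by exact_mod_cast hN : (0 : ℝ) < N)).add_posSemidef
    (Matrix.posSemidef_sum _ fun _ _ => posSemidef_vecMulVec _)

theorem trace_covBefore_le (hT : 0 < T) (hx : ∀ s < n, x s ∈ truncSimplex N T)
    (hr : ∀ s < n, 0 < r s) : (covBefore r x n).trace ≤ N * (N + n * (N * T) ^ 2) := by
  have hround : ∀ s ∈ Finset.range n,
      (Matrix.vecMulVec (lossGrad (r s) (x s)) (lossGrad (r s) (x s))).trace ≤
        N * (N * T : ℝ) ^ 2 := by
    intro s hs
    have hs := Finset.mem_range.1 hs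
    rw [Matrix.trace_vecMulVec, dotProduct]
    calc ∑ i, lossGrad (r s) (x s) i * lossGrad (r s) (x s) i
        ≤ ∑ _i : Fin N, (N * T : ℝ) ^ 2 := by
          refine Finset.sum_le_sum fun i _ => ?_
          rw [← sq]
          exact sq_le_sq.2 ((abs_lossGrad_le hT (hx s hs) (hr s hs) i).trans (le_abs_self _))
      _ = N * (N * T : ℝ) ^ 2 := by simp
  have hsum := Finset.sum_le_card_nsmul _ _ _ hround
  rw [Finset.card_range, nsmul_eq_mul] at hsum
  rw [covBefore, Matrix.trace_add, Matrix.trace_sum, Matrix.trace_smul, Matrix.trace_one,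
    Fintype.card_fin, smul_eq_mul]
  linarith

theorem log_det_covBefore_le (hN : 0 < N) (hNT : N < T) (hn : n ≤ T)
    (hx : ∀ s < n, x s ∈ truncSimplex N T) (hr : ∀ s < n, 0 < r s) :
    Real.log (covBefore r x n).det - Real.log (covBefore r x 0).det ≤ 6 * N * Real.log T := by
  have hT2 : (2 : ℝ) ≤ T := by exact_mod_cast (show 2 ≤ T by lia)
  have : (0 : ℝ) < N := by exact_mod_cast hN
  have hNT' : (N : ℝ) ≤ T := by exact_mod_cast hNT.le
  have hn' : (n : ℝ) ≤ T := by exact_mod_cast hn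
  have hpd := covBefore_posDef hN r x n
  have htrace : (covBefore r x n).trace ≤ N * (T : ℝ) ^ 6 := by
    refine (trace_covBefore_le (by lia) hx hr).trans ?_
    have hpow : (T : ℝ) ≤ T ^ 5 := le_self_pow₀ (by linarith) (by norm_num)
    calc (N : ℝ) * (N + n * (N * T) ^ 2) ≤ N * (T + T * ((T : ℝ) * T) ^ 2) := by gcongr
      _ = N * (T + (T : ℝ) ^ 5) := by ring
      _ ≤ N * (2 * (T : ℝ) ^ 5) := by gcongr; linarith
      _ ≤ N * (T * (T : ℝ) ^ 5) := by gcongr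
      _ = N * (T : ℝ) ^ 6 := by ring
  have hdet : (covBefore r x n).det ≤ (N * (T : ℝ) ^ 6) ^ N := by
    simpa only [Fintype.card_fin] using (det_le_trace_pow_card hpd.posSemidef).trans
      (pow_le_pow_left₀ hpd.posSemidef.trace_nonneg htrace _)
  have hdet0 : (covBefore r x 0).det = (N : ℝ) ^ N := by
    rw [covBefore_zero, Matrix.det_smul, Matrix.det_one, mul_one, Fintype.card_fin]
  calc Real.log (covBefore r x n).det - Real.log (covBefore r x 0).det
      ≤ Real.log ((N * (T : ℝ) ^ 6) ^ N) - Real.log ((N : ℝ) ^ N) := by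
        rw [hdet0]
        gcongr
        exact hpd.det_pos
    _ = 6 * N * Real.log T := by
        rw [Real.log_pow, Real.log_pow, Real.log_mul (by positivity) (by positivity), Real.log_pow]
        push_cast
        ring

end Covariance

/-! ### The regret of BARRONS -/

section Barrons

variable {N T : ℕ} {β η : ℝ} {r x : ℕ → Fin N → ℝ} {w : Fin N → ℝ} {n t : ℕ}

theorem half_le_log (hT : 1 < T) : 1 / 2 ≤ Real.log T := by
  have hT' : (2 : ℝ) ≤ T := by exact_mod_cast hT
  linarith [Real.log_le_log (by norm_num) hT', Real.log_two_gt_d9]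

theorem log_le_four_mul_log_pow_three (hT : 1 < T) : Real.log T ≤ 4 * Real.log T ^ 3 := by
  have hL := half_le_log hT
  have hsq : 1 ≤ 4 * Real.log T ^ 2 := by nlinarith
  calc Real.log T ≤ 4 * Real.log T ^ 2 * Real.log T := le_mul_of_one_le_left (by linarith) hsq
    _ = 4 * Real.log T ^ 3 := by ring

theorem barrons_succ_spec (hN : 0 < N) (hT : 0 < T) (β η : ℝ) (r : ℕ → Fin N → ℝ) (t : ℕ) :
    barrons T β η r (t + 1) ∈ truncSimplex N T ∧
      IsMinOn (omdObjective T β η r (barrons T β η r) t) (truncSimplex N T)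
        (barrons T β η r (t + 1)) := by
  rw [barrons_succ]
  refine argmin_spec (isCompact_truncSimplex N T) ⟨_, uniform_mem_truncSimplex hN hT⟩
    fun y hy => ContinuousAt.continuousWithinAt ?_
  exact (hasFDerivAt_dotProduct_add_bregman
    (differentiableAt_quadLog β _ _ (truncSimplex_pos hT hy)) _).continuousAt

theorem barrons_mem_truncSimplex (hN : 0 < N) (hT : 0 < T) (β η : ℝ) (r : ℕ → Fin N → ℝ) :
    ∀ t, barrons T β η r t ∈ truncSimplex N T
  | 0 => barrons_zero T β η r ▸ uniform_mem_truncSimplex hN hT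
  | t + 1 => (barrons_succ_spec hN hT β η r t).1

/-- The exponent `max_{s ≤ t} log_T (1 / (N x_{s,i}))` of the learning rate. -/
noncomputable def rateExp (T : ℕ) (x : ℕ → Fin N → ℝ) (t : ℕ) (i : Fin N) : ℝ :=
  (Finset.range (t + 1)).sup' Finset.nonempty_range_add_one fun s => Real.logb T (1 / (N * x s i))

theorem one_div_learningRate (T : ℕ) (η : ℝ) (x : ℕ → Fin N → ℝ) (t : ℕ) (i : Fin N) :
    1 / learningRate T η x t i = 1 / η * Real.exp (-rateExp T x t i) := by
  rw [learningRate, ← rateExp, Real.exp_neg]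
  ring

theorem rateExp_zero (hx : x 0 = fun _ => 1 / (N : ℝ)) (i : Fin N) : rateExp T x 0 i = 0 := by
  have hN : (N : ℝ) ≠ 0 := by exact_mod_cast i.pos.ne'
  simp [rateExp, hx, hN]

theorem rateExp_succ (T : ℕ) (x : ℕ → Fin N → ℝ) (t : ℕ) (i : Fin N) :
    rateExp T x (t + 1) i = max (rateExp T x t i) (Real.logb T (1 / (N * x (t + 1) i))) := by
  rw [max_comm]
  exact (Finset.sup'_congr _ Finset.range_add_one fun _ _ => rfl).trans
    (Finset.sup'_insert (f := fun s => Real.logb T (1 / (N * x s i)))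
      Finset.nonempty_range_add_one)

theorem mul_rpow_logb_one_div (hT : 1 < T) (a : ℝ) {z : ℝ} (hN : 0 < N) (hz : 0 < z) :
    N * a * (T : ℝ) ^ Real.logb T (1 / (N * z)) = a / z := by
  have : (0 : ℝ) < N := by exact_mod_cast hN
  have hT' : (1 : ℝ) < T := by exact_mod_cast hT
  rw [Real.rpow_logb (by linarith) hT'.ne' (by positivity)]
  field_simp

theorem logb_one_div_le_one (hT : 1 < T) {x : Fin N → ℝ} (hx : x ∈ truncSimplex N T) (i : Fin N) :
    Real.logb T (1 / (N * x i)) ≤ 1 := by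
  have hN : (0 : ℝ) < N := by exact_mod_cast i.pos
  have hT' : (1 : ℝ) < T := by exact_mod_cast hT
  have hxi := truncSimplex_pos (by lia) hx i
  rw [Real.logb_le_iff_le_rpow hT' (by positivity), Real.rpow_one, ← div_div, div_right_comm,
    div_le_iff₀ hN, mul_comm]
  exact one_div_le_of_mem_truncSimplex (by lia) hx i

/-- An upper bound, with floor `6` in each coordinate, on the ratios `w_i / x_{s,i}` over the rounds
`s ≤ t`; it also bounds the wealth ratios of `w` over the plays. The floor is where
`half_le_itakuraSaito` starts. -/
noncomputable def wealthCap (T : ℕ) (x : ℕ → Fin N → ℝ) (w : Fin N → ℝ) (t : ℕ) : ℝ :=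
  ∑ i, max (N * w i * (T : ℝ) ^ rateExp T x t i) 6

theorem wealthCap_nonneg (T : ℕ) (x : ℕ → Fin N → ℝ) (w : Fin N → ℝ) (t : ℕ) :
    0 ≤ wealthCap T x w t :=
  Finset.sum_nonneg fun _ _ => le_max_of_le_right (by norm_num)

theorem wealthCap_zero_le (hx : x 0 = fun _ => 1 / (N : ℝ)) (hw : w ∈ stdSimplex ℝ (Fin N)) :
    wealthCap T x w 0 ≤ 7 * N := by
  calc wealthCap T x w 0 ≤ ∑ i, (N * w i + 6) := by
        refine Finset.sum_le_sum fun i _ => ?_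
        have := mul_nonneg (Nat.cast_nonneg N) (hw.1 i)
        rw [rateExp_zero hx, Real.rpow_zero, mul_one]
        exact max_le (by linarith) (by linarith)
    _ = 7 * N := by
        rw [Finset.sum_add_distrib, ← Finset.mul_sum, hw.2]
        simp only [Finset.sum_const, Finset.card_univ, Fintype.card_fin, nsmul_eq_mul]
        ring

theorem wealthRatio_le_wealthCap (hT : 1 < T) {s : ℕ} (hst : s ≤ t) (hx : ∀ i, 0 < x s i)
    (hw : ∀ i, 0 ≤ w i) {p : Fin N → ℝ} (hp : 0 < p) :
    wealthRatio p (x s) w ≤ wealthCap T x w t := by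
  obtain ⟨i, hi⟩ := exists_wealthRatio_le_div hx hp w
  have hT' : (1 : ℝ) ≤ T := by exact_mod_cast hT.le
  have hexp : Real.logb T (1 / (N * x s i)) ≤ rateExp T x t i :=
    Finset.le_sup' (fun s => Real.logb T (1 / (N * x s i))) (Finset.mem_range.2 (by lia))
  calc wealthRatio p (x s) w ≤ w i / x s i := hi
    _ = N * w i * (T : ℝ) ^ Real.logb T (1 / (N * x s i)) :=
        (mul_rpow_logb_one_div hT _ i.pos (hx i)).symm
    _ ≤ N * w i * (T : ℝ) ^ rateExp T x t i :=
        mul_le_mul_of_nonneg_left (Real.rpow_le_rpow_of_exponent_le hT' hexp)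
          (mul_nonneg (Nat.cast_nonneg N) (hw i))
    _ ≤ max (N * w i * (T : ℝ) ^ rateExp T x t i) 6 := le_max_left _ _
    _ ≤ wealthCap T x w t :=
        Finset.single_le_sum (f := fun i => max (N * w i * (T : ℝ) ^ rateExp T x t i) 6)
          (fun _ _ => le_max_of_le_right (by norm_num)) (Finset.mem_univ i)

theorem sum_learningRate_change_le (hT : 1 < T) (hη : 0 < η) (hx : x (t + 1) ∈ truncSimplex N T)
    (hw : ∀ i, 0 < w i) :
    ∑ i, (1 / learningRate T η x (t + 1) i - 1 / learningRate T η x t i) *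
        itakuraSaito (w i / x (t + 1) i) ≤
      -(Real.exp (-1) / (2 * η * Real.log T)) * (wealthCap T x w (t + 1) - wealthCap T x w t) := by
  rw [wealthCap, wealthCap, ← Finset.sum_sub_distrib, Finset.mul_sum]
  refine Finset.sum_le_sum fun i _ => ?_
  have hN : (0 : ℝ) < N := by exact_mod_cast i.pos
  have hchange := exp_neg_sub_mul_itakuraSaito_le (g := rateExp T x t i)
    (show (1 : ℝ) < T by exact_mod_cast hT) (mul_pos hN (hw i)) (logb_one_div_le_one hT hx i)
  rw [← rateExp_succ, mul_rpow_logb_one_div hT _ i.pos (truncSimplex_pos (by lia) hx i)] at hchange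
  have hscaled := mul_le_mul_of_nonneg_left hchange (one_div_nonneg.2 hη.le)
  rw [one_div_learningRate, one_div_learningRate]
  calc _ = 1 / η * ((Real.exp (-rateExp T x (t + 1) i) - Real.exp (-rateExp T x t i)) *
        itakuraSaito (w i / x (t + 1) i)) := by ring
    _ ≤ _ := hscaled
    _ = _ := by field_simp

/-- The potential `D_{n-1}(w, x_n) + κ * wealthCap - ln det A_{n-1} / (2 β)` before round `n`, where
`D_{n-1}` is the divergence of the regularizer with the covariance of the first `n` rounds and the
learning rates of round `n`, and `κ = 1 / (2 e η ln T)`. -/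
noncomputable def potential (T : ℕ) (β η : ℝ) (r x : ℕ → Fin N → ℝ) (w : Fin N → ℝ) (n : ℕ) : ℝ :=
  quadLogDiv β (covBefore r x n) (fun i => 1 / learningRate T η x n i) w (x n) +
    Real.exp (-1) / (2 * η * Real.log T) * wealthCap T x w n -
    1 / (2 * β) * Real.log (covBefore r x n).det

theorem linearized_regret_le_potential_sub (hN : 0 < N) (hT : 1 < T) (hβ : 0 < β) (hη : 0 < η)
    (hx : x = barrons T β η r) (hw : w ∈ truncSimplex N T) (n : ℕ) :
    lossGrad (r n) (x n) ⬝ᵥ (x n - w) - β / 2 * (lossGrad (r n) (x n) ⬝ᵥ (x n - w)) ^ 2 ≤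
      potential T β η r x w n - potential T β η r x w (n + 1) := by
  have hT0 : 0 < T := by lia
  have hmem : ∀ t, x t ∈ truncSimplex N T := hx ▸ barrons_mem_truncSimplex hN hT0 β η r
  have hmin := (barrons_succ_spec hN hT0 β η r n).2
  rw [← hx] at hmin
  have hmirror := dotProduct_sub_le_quadLogDiv (convex_truncSimplex N T)
    (fun _ hy => truncSimplex_pos hT0 hy) hβ (covBefore_posDef hN r x (n + 1))
    (c := fun i => 1 / learningRate T η x n i)
    (fun i => by rw [one_div_learningRate]; positivity) (hmem n) (hmem (n + 1)) hw hmin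
  have hquad := quadLogDiv_add_vecMulVec β (covBefore r x n)
    (fun i => 1 / learningRate T η x n i) (lossGrad (r n) (x n)) w (x n)
  have hdet := mul_le_mul_of_nonneg_left
    (dotProduct_inv_mulVec_le_log_det (covBefore_posDef hN r x n) (lossGrad (r n) (x n)))
    (show 0 ≤ 1 / (2 * β) by positivity)
  rw [← covBefore_succ] at hquad hdet
  have hrates := sum_learningRate_change_le hT hη (hmem (n + 1)) (truncSimplex_pos hT0 hw)
  rw [← quadLogDiv_sub_quadLogDiv β (covBefore r x (n + 1))] at hrates
  rw [potential, potential]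
  linarith

theorem sum_itakuraSaito_uniform_le (hT : 0 < T) (hw : w ∈ truncSimplex N T) :
    ∑ i, itakuraSaito (w i / (1 / (N : ℝ))) ≤ N * Real.log T := by
  calc ∑ i, itakuraSaito (w i / (1 / (N : ℝ))) ≤ ∑ i, (N * w i - 1 + Real.log T) := by
        refine Finset.sum_le_sum fun i _ => ?_
        have hwi := truncSimplex_pos hT hw i
        have hN : (0 : ℝ) < N := by exact_mod_cast i.pos
        have hlog : Real.log (1 / w i) ≤ Real.log (N * T) :=
          Real.log_le_log (by positivity) (one_div_le_of_mem_truncSimplex hT hw i)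
        rw [one_div, Real.log_inv, Real.log_mul hN.ne' (by positivity)] at hlog
        rw [itakuraSaito, div_div_eq_mul_div, div_one, Real.log_mul hwi.ne' hN.ne', mul_comm]
        linarith
    _ = N * Real.log T := by
        rw [Finset.sum_add_distrib, Finset.sum_sub_distrib, ← Finset.mul_sum, hw.1.2]
        simp

theorem form_sub_uniform_le (hw : w ∈ stdSimplex ℝ (Fin N)) :
    (w - fun _ => 1 / (N : ℝ)) ⬝ᵥ
      (((N : ℝ) • (1 : Matrix (Fin N) (Fin N) ℝ)) *ᵥ (w - fun _ => 1 / (N : ℝ))) ≤ (N : ℝ) ^ 2 := by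
  rw [Matrix.smul_mulVec, Matrix.one_mulVec, dotProduct_smul, smul_eq_mul, sq]
  gcongr
  calc (w - fun _ => 1 / (N : ℝ)) ⬝ᵥ (w - fun _ => 1 / (N : ℝ)) ≤ ∑ _i : Fin N, (1 : ℝ) := by
        refine Finset.sum_le_sum fun i _ => ?_
        obtain ⟨hw0, hw1⟩ := mem_Icc_of_mem_stdSimplex hw i
        have hN0 : 0 ≤ 1 / (N : ℝ) := by positivity
        have hN1 : 1 / (N : ℝ) ≤ 1 :=
          div_le_one_of_le₀ (by exact_mod_cast i.pos) (Nat.cast_nonneg N)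
        rw [Pi.sub_apply, ← sq, sq_le_one_iff_abs_le_one, abs_le]
        constructor <;> linarith
    _ = N := by simp

theorem quadLogDiv_uniform_le (hT : 0 < T) (hβ : 0 < β) (hβ2 : β ≤ 1 / 2) (hη : 0 < η)
    (hw : w ∈ truncSimplex N T) :
    quadLogDiv β ((N : ℝ) • 1) (fun _ => 1 / η) w (fun _ => 1 / (N : ℝ)) ≤
      (N : ℝ) ^ 2 / 4 + N * Real.log T / η := by
  rw [quadLogDiv, ← Finset.mul_sum]
  calc _ ≤ β / 2 * (N : ℝ) ^ 2 + 1 / η * (N * Real.log T) := by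
        gcongr
        exacts [form_sub_uniform_le hw.1, sum_itakuraSaito_uniform_le hT hw]
    _ ≤ 1 / 2 / 2 * (N : ℝ) ^ 2 + 1 / η * (N * Real.log T) := by gcongr
    _ = _ := by ring

/-- The regret over the first `n` rounds of the plays `x` against `w`, for positive portfolios. -/
noncomputable def cumRegret (r : ℕ → Fin N → ℝ) (n : ℕ) (x : ℕ → Fin N → ℝ) (w : Fin N → ℝ) : ℝ :=
  ∑ s ∈ Finset.range n, (loss (r s) (x s) - loss (r s) w)

theorem cumRegret_barrons_le_potential_sub (hN : 0 < N) (hT : 1 < T) (hβ : 0 < β) (hβ2 : β ≤ 1 / 2)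
    (hη : 0 < η) (hx : x = barrons T β η r) (hw : w ∈ truncSimplex N T) (hr : ∀ s < n, 0 < r s)
    (hcurv : ∀ s < n, β * wealthRatio (r s) (x s) w ≤ 1) :
    cumRegret r n x w ≤ potential T β η r x w 0 - potential T β η r x w n := by
  have hT0 : 0 < T := by lia
  rw [← Finset.sum_range_sub', cumRegret]
  refine Finset.sum_le_sum fun s hs => ?_
  have hsn := Finset.mem_range.1 hs
  have hxs : ∀ i, 0 < x s i :=
    truncSimplex_pos hT0 (hx ▸ barrons_mem_truncSimplex hN hT0 β η r s)
  exact (loss_sub_loss_le hβ2 (dotProduct_pos hxs (hr s hsn))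
    (dotProduct_pos (truncSimplex_pos hT0 hw) (hr s hsn)) (hcurv s hsn)).trans
    (linearized_regret_le_potential_sub hN hT hβ hη hx hw s)

theorem potential_zero_le (hT : 1 < T) (hβ : 0 < β) (hβ2 : β ≤ 1 / 2) (hη : 0 < η)
    (hx : x 0 = fun _ => 1 / (N : ℝ)) (hw : w ∈ truncSimplex N T) :
    potential T β η r x w 0 ≤ (N : ℝ) ^ 2 / 4 + N * Real.log T / η +
      Real.exp (-1) / (2 * η * Real.log T) * (7 * N) -
      1 / (2 * β) * Real.log (covBefore r x 0).det := by
  have hlog : 0 < Real.log T := by linarith [half_le_log hT]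
  have hrate : (fun i => 1 / learningRate T η x 0 i) = fun _ => 1 / η := by
    funext i
    rw [one_div_learningRate, rateExp_zero hx, neg_zero, Real.exp_zero, mul_one]
  rw [potential, hrate, hx]
  gcongr
  · rw [covBefore_zero]
    exact quadLogDiv_uniform_le (by lia) hβ hβ2 hη hw
  · exact wealthCap_zero_le hx hw.1

theorem le_potential (hN : 0 < N) (hT : 0 < T) (hβ : 0 ≤ β) (hη : 0 ≤ η)
    (hx : x n ∈ truncSimplex N T) (hw : w ∈ truncSimplex N T) :
    Real.exp (-1) / (2 * η * Real.log T) * wealthCap T x w n -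
      1 / (2 * β) * Real.log (covBefore r x n).det ≤ potential T β η r x w n := by
  have hdiv : 0 ≤ quadLogDiv β (covBefore r x n) (fun i => 1 / learningRate T η x n i) w (x n) :=
    quadLogDiv_nonneg hβ (covBefore_posDef hN r x n).posSemidef
      (fun i => by rw [one_div_learningRate]; positivity) (truncSimplex_pos hT hw)
      (truncSimplex_pos hT hx)
  rw [potential]
  linarith

theorem cumRegret_barrons_le (hN : 0 < N) (hNT : N < T) (hβ : 0 < β) (hβ2 : β ≤ 1 / 2)
    (hη : 0 < η) (hx : x = barrons T β η r) (hw : w ∈ truncSimplex N T) (hn : n ≤ T)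
    (hr : ∀ s < n, 0 < r s) (hcurv : ∀ s < n, β * wealthRatio (r s) (x s) w ≤ 1) :
    cumRegret r n x w + Real.exp (-1) / (2 * η * Real.log T) * wealthCap T x w n ≤
      (N : ℝ) ^ 2 / 4 + N * Real.log T / η + Real.exp (-1) / (2 * η * Real.log T) * (7 * N) +
        3 * (N * Real.log T) / β := by
  have hT : 1 < T := by lia
  have hmem : ∀ t, x t ∈ truncSimplex N T :=
    hx ▸ barrons_mem_truncSimplex hN (by lia) β η r
  have htelescope := cumRegret_barrons_le_potential_sub hN hT hβ hβ2 hη hx hw hr hcurv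
  have hstart := potential_zero_le (r := r) (x := x) hT hβ hβ2 hη (by rw [hx, barrons_zero]) hw
  have hend := le_potential (r := r) hN (by lia) hβ.le hη.le (hmem n) hw
  have hdet := mul_le_mul_of_nonneg_left
    (log_det_covBefore_le hN hNT hn (fun s _ => hmem s) hr) (show 0 ≤ 1 / (2 * β) by positivity)
  have hscale : 1 / (2 * β) * (6 * N * Real.log T) = 3 * (N * Real.log T) / β := by
    field_simp
    ring
  linarith

theorem adaEta_pos (hN : 0 < N) (hT : 1 < T) : 0 < adaEta N T := by
  have := half_le_log hT
  unfold adaEta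
  positivity

theorem mul_log_div_adaEta (N T : ℕ) :
    N * Real.log T / adaEta N T = 2048 * (N ^ 2 * Real.log T ^ 3) := by
  rw [adaEta]
  field_simp

theorem exp_neg_one_div_two_mul_adaEta_mul_log (N T : ℕ) :
    Real.exp (-1) / (2 * adaEta N T * Real.log T) =
      1024 * Real.exp (-1) * (N * Real.log T) := by
  rw [adaEta]
  field_simp
  ring

theorem cumRegret_barrons_adaEta_le (hN : 0 < N) (hNT : N < T) (hβ : 0 < β) (hβ2 : β ≤ 1 / 2)
    (hx : x = barrons T β (adaEta N T) r) (hw : w ∈ truncSimplex N T) (hn : n ≤ T)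
    (hr : ∀ s < n, 0 < r s) (hcurv : ∀ s < n, β * wealthRatio (r s) (x s) w ≤ 1) :
    cumRegret r n x w + 360 * (N * Real.log T) * wealthCap T x w n ≤
      16000 * (N ^ 2 * Real.log T ^ 3) + 3 * (N * Real.log T) / β := by
  have hT : 1 < T := by lia
  have hL := half_le_log hT
  have hregret := cumRegret_barrons_le hN hNT hβ hβ2 (adaEta_pos hN hT) hx hw hn hr hcurv
  have hcap := wealthCap_nonneg T x w n
  rw [exp_neg_one_div_two_mul_adaEta_mul_log, mul_log_div_adaEta] at hregret
  set L := Real.log T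
  have he : Real.exp (-1) ∈ Set.Icc (360 / 1024) (380 / 1024) := by
    constructor <;> linarith [Real.exp_neg_one_gt_d9, Real.exp_neg_one_lt_d9]
  have hlower : 360 * (N * L) * wealthCap T x w n ≤
      1024 * Real.exp (-1) * (N * L) * wealthCap T x w n := by
    gcongr
    linarith [he.1]
  have hupper : 1024 * Real.exp (-1) * (N * L) * (7 * N) ≤ 10640 * (N ^ 2 * L ^ 3) := by
    calc 1024 * Real.exp (-1) * (N * L) * (7 * N) ≤ 380 * (N * L) * (7 * N) := by
          gcongr
          linarith [he.2]
      _ = 2660 * (N ^ 2 * L) := by ring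
      _ ≤ 2660 * (N ^ 2 * (4 * L ^ 3)) := by
          gcongr
          exact log_le_four_mul_log_pow_three hT
      _ = 10640 * (N ^ 2 * L ^ 3) := by ring
  have hquad : (N : ℝ) ^ 2 * (1 / 2) ^ 3 ≤ N ^ 2 * L ^ 3 := by gcongr
  have : 0 ≤ N ^ 2 * L ^ 3 := by positivity
  linarith

end Barrons

/-! ### Near-optimal portfolios and the restart condition -/

section Leader

variable {N T : ℕ} {r x : ℕ → Fin N → ℝ} {n t : ℕ} {c β : ℝ}

theorem log_mul_le_two_mul_log (hN : 0 < N) (hNT : N ≤ T) :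
    Real.log (N * T) ≤ 2 * Real.log T := by
  have hN' : (0 : ℝ) < N := by exact_mod_cast hN
  have hNT' : (N : ℝ) ≤ T := by exact_mod_cast hNT
  rw [Real.log_mul hN'.ne' (hN'.trans_le hNT').ne']
  linarith [Real.log_le_log hN' hNT']

theorem log_mul_le_two_mul_mul_log (hN : 0 < N) (hNT : N ≤ T) :
    Real.log (N * T) ≤ 2 * (N * Real.log T) :=
  (log_mul_le_two_mul_log hN hNT).trans (mul_le_mul_of_nonneg_left
    (le_mul_of_one_le_left (Real.log_natCast_nonneg T) (by exact_mod_cast hN)) zero_le_two)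

theorem loss_sub_loss_le_log (hT : 0 < T) {p y w : Fin N → ℝ} (hy : y ∈ truncSimplex N T)
    (hw : w ∈ truncSimplex N T) (hp : 0 < p) : loss p y - loss p w ≤ Real.log (N * T) := by
  have hypos := truncSimplex_pos hT hy
  have hwpos := truncSimplex_pos hT hw
  rw [loss_sub_loss (dotProduct_pos hypos hp) (dotProduct_pos hwpos hp)]
  exact Real.log_le_log (wealthRatio_pos hypos hwpos hp)
    (wealthRatio_le_of_mem_truncSimplex hT hp hy (truncSimplex_le_one hw))

theorem convexOn_loss (hT : 0 < T) {p : Fin N → ℝ} (hp : 0 < p) :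
    ConvexOn ℝ (truncSimplex N T) (loss p) := by
  refine ⟨convex_truncSimplex N T, fun a ha b hb l m hl hm hlm => ?_⟩
  have hlog := strictConcaveOn_log_Ioi.concaveOn.2 (dotProduct_pos (truncSimplex_pos hT ha) hp)
    (dotProduct_pos (truncSimplex_pos hT hb) hp) hl hm hlm
  simp only [smul_eq_mul] at hlog
  simp only [loss, add_dotProduct, smul_dotProduct, smul_eq_mul]
  linarith

/-- The cumulative loss of the constant portfolio `u` over the first `n` rounds. -/
noncomputable def cumLoss (r : ℕ → Fin N → ℝ) (n : ℕ) (u : Fin N → ℝ) : ℝ :=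
  ∑ s ∈ Finset.range n, loss (r s) u

theorem cumLoss_zero (r : ℕ → Fin N → ℝ) : cumLoss r 0 = fun _ => 0 := by
  simp [funext_iff, cumLoss]

theorem cumLoss_succ (r : ℕ → Fin N → ℝ) (n : ℕ) :
    cumLoss r (n + 1) = cumLoss r n + loss (r n) :=
  funext fun _ => Finset.sum_range_succ _ _

theorem convexOn_cumLoss (hT : 0 < T) (hr : ∀ s < n, 0 < r s) :
    ConvexOn ℝ (truncSimplex N T) (cumLoss r n) := by
  induction n with
  | zero => exact cumLoss_zero r ▸ convexOn_const 0 (convex_truncSimplex N T)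
  | succ n ih =>
    rw [cumLoss_succ]
    exact (ih fun s hs => hr s (by lia)).add (convexOn_loss hT (hr n (by lia)))

theorem continuousOn_cumLoss (hT : 0 < T) (hr : ∀ s < n, 0 < r s) :
    ContinuousOn (cumLoss r n) (truncSimplex N T) :=
  continuousOn_finsetSum _ fun s hs _ hy => (hasFDerivAt_loss (dotProduct_pos
    (truncSimplex_pos hT hy) (hr s (Finset.mem_range.1 hs)))).continuousAt.continuousWithinAt

theorem cumRegret_eq_add_cumLoss_sub (r x : ℕ → Fin N → ℝ) (n : ℕ) (v w : Fin N → ℝ) :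
    cumRegret r n x v = cumRegret r n x w + (cumLoss r n w - cumLoss r n v) := by
  rw [cumRegret, cumRegret, cumLoss, cumLoss, Finset.sum_sub_distrib, Finset.sum_sub_distrib]
  ring

/-- The portfolios of the truncated simplex whose cumulative loss over the first `n` rounds is
within `c` of the smallest one there. The comparators in the analysis of an epoch are taken from
such sets. -/
def nearOptimal (T : ℕ) (r : ℕ → Fin N → ℝ) (n : ℕ) (c : ℝ) : Set (Fin N → ℝ) :=
  {u ∈ truncSimplex N T | ∀ v ∈ truncSimplex N T, cumLoss r n u ≤ cumLoss r n v + c}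

theorem nearOptimal_mono {c' : ℝ} (hc : c ≤ c') : nearOptimal T r n c ⊆ nearOptimal T r n c' :=
  fun _ hu => ⟨hu.1, fun v hv => (hu.2 v hv).trans (by gcongr)⟩

theorem convex_nearOptimal (hT : 0 < T) (hr : ∀ s < n, 0 < r s) (c : ℝ) :
    Convex ℝ (nearOptimal T r n c) := fun _ ha _ hb _ _ hl hm hlm =>
  ⟨convex_truncSimplex N T ha.1 hb.1 hl hm hlm, fun v hv =>
    ((convexOn_cumLoss hT hr).convex_le _ ⟨ha.1, ha.2 v hv⟩ ⟨hb.1, hb.2 v hv⟩ hl hm hlm).2⟩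

theorem nearOptimal_succ_subset (hT : 0 < T) (hr : 0 < r n) :
    nearOptimal T r (n + 1) c ⊆ nearOptimal T r n (c + Real.log (N * T)) := by
  refine fun u hu => ⟨hu.1, fun v hv => ?_⟩
  have hopt := hu.2 v hv
  rw [cumLoss_succ, Pi.add_apply, Pi.add_apply] at hopt
  linarith [loss_sub_loss_le_log hT hv hu.1 hr]

theorem cumRegret_le_of_mem_nearOptimal {w v : Fin N → ℝ} (hw : w ∈ nearOptimal T r n c)
    (hv : v ∈ truncSimplex N T) : cumRegret r n x v ≤ cumRegret r n x w + c := by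
  linarith [cumRegret_eq_add_cumLoss_sub r x n v w, hw.2 v hv]

theorem sum_log_one_div_mem_Icc (hT : 0 < T) {u : Fin N → ℝ} (hu : u ∈ truncSimplex N T) :
    ∑ i, Real.log (1 / u i) ∈ Set.Icc 0 (N * Real.log (N * T)) := by
  have hpos := truncSimplex_pos hT hu
  constructor
  · exact Finset.sum_nonneg fun i _ =>
      Real.log_nonneg ((one_le_div (hpos i)).2 (truncSimplex_le_one hu i))
  · calc ∑ i, Real.log (1 / u i) ≤ ∑ _i : Fin N, Real.log (N * T) :=
          Finset.sum_le_sum fun i _ => Real.log_le_log (one_div_pos.2 (hpos i))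
            (one_div_le_of_mem_truncSimplex hT hu i)
      _ = N * Real.log (N * T) := by simp

theorem regLeader_mem_nearOptimal (hN : 0 < N) (hT : 0 < T) {γ : ℝ} (hγ : 0 < γ)
    (hr : ∀ s ≤ t, 0 < r s) :
    regLeader T γ r t ∈ nearOptimal T r (t + 1) (1 / γ * (N * Real.log (N * T))) := by
  have hcont : ContinuousOn (fun u => cumLoss r (t + 1) u + 1 / γ * ∑ i, Real.log (1 / u i))
      (truncSimplex N T) := by
    refine (continuousOn_cumLoss hT fun s hs => hr s (by lia)).add (continuousOn_const.mul
      (continuousOn_finsetSum _ fun i _ => ContinuousOn.log (continuousOn_const.div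
        (continuous_apply i).continuousOn fun u hu => (truncSimplex_pos hT hu i).ne')
        fun u hu => ?_))
    exact (one_div_pos.2 (truncSimplex_pos hT hu i)).ne'
  obtain ⟨hmem, hmin⟩ : regLeader T γ r t ∈ truncSimplex N T ∧ IsMinOn _ _ (regLeader T γ r t) :=
    argmin_spec (isCompact_truncSimplex N T) ⟨_, uniform_mem_truncSimplex hN hT⟩ hcont
  refine ⟨hmem, fun v hv => ?_⟩
  have hobj : cumLoss r (t + 1) (regLeader T γ r t) +
        1 / γ * ∑ i, Real.log (1 / regLeader T γ r t i) ≤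
      cumLoss r (t + 1) v + 1 / γ * ∑ i, Real.log (1 / v i) := hmin hv
  have hleader : 0 ≤ 1 / γ * ∑ i, Real.log (1 / regLeader T γ r t i) :=
    mul_nonneg (by positivity) (sum_log_one_div_mem_Icc hT hmem).1
  have hcomp : 1 / γ * ∑ i, Real.log (1 / v i) ≤ 1 / γ * (N * Real.log (N * T)) :=
    mul_le_mul_of_nonneg_left (sum_log_one_div_mem_Icc hT hv).2 (by positivity)
  linarith

theorem regLeader_adaGamma_mem_nearOptimal (hN : 0 < N) (hNT : N < T) (hr : ∀ s ≤ t, 0 < r s) :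
    regLeader T adaGamma r t ∈ nearOptimal T r (t + 1) (50 * (N * Real.log T)) := by
  refine nearOptimal_mono ?_ (regLeader_mem_nearOptimal hN (by lia) (by norm_num [adaGamma]) hr)
  rw [adaGamma]
  linarith [mul_le_mul_of_nonneg_left (log_mul_le_two_mul_log hN hNT.le)
    (Nat.cast_nonneg (α := ℝ) N)]

theorem regLeader_adaGamma_mem_nearOptimal_pred (hN : 0 < N) (hNT : N < T)
    (hr : ∀ s ≤ t, 0 < r s) :
    regLeader T adaGamma r t ∈ nearOptimal T r t (52 * (N * Real.log T)) := by
  refine nearOptimal_mono ?_ (nearOptimal_succ_subset (by lia) (hr t le_rfl)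
    (regLeader_adaGamma_mem_nearOptimal hN hNT hr))
  linarith [log_mul_le_two_mul_mul_log hN hNT.le]

theorem ofReal_le_one_div_ofReal {β z : ℝ} (hβ : 0 ≤ β) :
    ENNReal.ofReal β ≤ 1 / ENNReal.ofReal z ↔ β * z ≤ 1 := by
  rw [ENNReal.le_div_iff_mul_le (Or.inr one_ne_zero) (Or.inr ENNReal.one_ne_top),
    ← ENNReal.ofReal_mul hβ, ENNReal.ofReal_le_one]

theorem ofReal_le_alpha_iff (hβ : 0 ≤ β) (hβ2 : β ≤ 1 / 2) (hx : ∀ s ≤ t, 0 < x s ⬝ᵥ r s)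
    (u : Fin N → ℝ) :
    ENNReal.ofReal β ≤ alpha r x t u ↔
      ∀ s ≤ t, β * (8 * |wealthRatio (r s) (x s) u - 1|) ≤ 1 := by
  have hhalf : ENNReal.ofReal β ≤ 1 / 2 := by
    rw [show (1 / 2 : ℝ≥0∞) = 1 / ENNReal.ofReal 2 by simp, ofReal_le_one_div_ofReal hβ]
    linarith
  simp only [alpha, le_min_iff, hhalf, true_and, le_iInf_iff, Finset.mem_range, Nat.lt_succ_iff]
  refine forall₂_congr fun s hs => ?_
  rw [ofReal_le_one_div_ofReal hβ, dotProduct_comm, ← neg_sub (x s) u, dotProduct_neg, abs_neg,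
    lossGrad_dotProduct_sub (hx s hs)]

theorem mul_wealthRatio_le_one_of_le_alpha (hβ : 0 ≤ β) (hβ2 : β ≤ 1 / 2)
    (hx : ∀ s ≤ t, 0 < x s ⬝ᵥ r s) {u : Fin N → ℝ} (h : ENNReal.ofReal β ≤ alpha r x t u) {s : ℕ}
    (hs : s ≤ t) : β * wealthRatio (r s) (x s) u ≤ 1 := by
  have hround := (ofReal_le_alpha_iff hβ hβ2 hx u).1 h s hs
  have habs := mul_le_mul_of_nonneg_left (le_abs_self (wealthRatio (r s) (x s) u - 1)) hβ
  linarith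

theorem exists_inv_le_max_of_alpha_lt (hβ : 0 < β) (hβ2 : β ≤ 1 / 2)
    (hx : ∀ s ≤ t, 0 < x s ⬝ᵥ r s) {u : Fin N → ℝ}
    (hu : ∀ s ≤ t, 0 ≤ wealthRatio (r s) (x s) u)
    (h : alpha r x t u < ENNReal.ofReal β) :
    ∃ s ≤ t, β⁻¹ ≤ 8 * max 1 (wealthRatio (r s) (x s) u) := by
  have hfar := (ofReal_le_alpha_iff hβ.le hβ2 hx u).not.1 h.not_ge
  push Not at hfar
  obtain ⟨s, hs, hfar⟩ := hfar
  refine ⟨s, hs, ?_⟩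
  have habs : |wealthRatio (r s) (x s) u - 1| ≤ max 1 (wealthRatio (r s) (x s) u) :=
    abs_le.2 ⟨by linarith [hu s hs, le_max_left 1 (wealthRatio (r s) (x s) u)],
      by linarith [le_max_right 1 (wealthRatio (r s) (x s) u)]⟩
  linarith [(inv_le_iff_one_le_mul₀' hβ).2 hfar.le]

end Leader

/-! ### The regret of an epoch -/

section Epoch

theorem exists_mem_segment_forall_le_and_eq {E ι : Type*} [AddCommGroup E] [Module ℝ E]
    [TopologicalSpace E] [ContinuousAdd E] [ContinuousSMul ℝ E] {I : Finset ι} {f : ι → E → ℝ}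
    {a b : E} {c : ℝ} (hf : ∀ i ∈ I, ContinuousOn (f i) (segment ℝ a b))
    (ha : ∀ i ∈ I, f i a ≤ c) (hb : ∃ i ∈ I, c ≤ f i b) :
    ∃ w ∈ segment ℝ a b, (∀ i ∈ I, f i w ≤ c) ∧ ∃ i ∈ I, f i w = c := by
  obtain ⟨j, hj, hbj⟩ := hb
  have hI : I.Nonempty := ⟨j, hj⟩
  obtain ⟨w, hw, hwc⟩ := (convex_segment (𝕜 := ℝ) a b).isPreconnected.intermediate_value
    (left_mem_segment ℝ a b) (right_mem_segment ℝ a b) (ContinuousOn.finset_sup'_apply hI hf)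
    ⟨Finset.sup'_le hI _ ha, hbj.trans (Finset.le_sup' (f · b) hj)⟩
  obtain ⟨i, hi, hwi⟩ := Finset.exists_mem_eq_sup' hI (f · w)
  exact ⟨w, hw, fun k hk => hwc ▸ Finset.le_sup' (f · w) hk, i, hi, hwi ▸ hwc⟩

variable {N T : ℕ} {β : ℝ} {r x : ℕ → Fin N → ℝ} {n : ℕ}

theorem continuous_wealthRatio {ι : Type*} [Fintype ι] (p y : ι → ℝ) :
    Continuous (wealthRatio p y) :=
  (continuous_id.dotProduct continuous_const).div_const _

/-- The restart condition fails after each of the first `n` rounds of an epoch with parameter `β`,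
price relatives `r` and plays `x`. -/
def Survives (T : ℕ) (β : ℝ) (r x : ℕ → Fin N → ℝ) (n : ℕ) : Prop :=
  ∀ m < n, ENNReal.ofReal β ≤ alpha r x m (regLeader T adaGamma r m)

theorem Survives.exists_nearOptimal (h : Survives T β r x n) (hN : 0 < N) (hNT : N < T)
    (hβ : 0 ≤ β) (hβ2 : β ≤ 1 / 2) (hx : ∀ s, x s ∈ truncSimplex N T) (hr : ∀ s < n, 0 < r s) :
    ∃ a ∈ nearOptimal T r n (50 * (N * Real.log T)),
      ∀ s < n, β * wealthRatio (r s) (x s) a ≤ 1 := by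
  obtain _ | m := n
  · have := Real.log_natCast_nonneg T
    refine ⟨_, ⟨uniform_mem_truncSimplex hN (by lia), fun v _ => ?_⟩, by simp⟩
    rw [cumLoss_zero]
    positivity
  · exact ⟨_, regLeader_adaGamma_mem_nearOptimal hN hNT fun s hs => hr s (by lia), fun s hs =>
      mul_wealthRatio_le_one_of_le_alpha hβ hβ2 (fun k hk => dotProduct_pos
        (truncSimplex_pos (by lia) (hx k)) (hr k (by lia))) (h m (by lia)) (by lia)⟩

-- If the leader `b` at the restart violates the curvature condition in an earlier round, move from
-- a near-optimal portfolio `a` that satisfies it towards `b`, up to the first violation.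
theorem exists_nearOptimal_of_restart (hN : 0 < N) (hNT : N < T) (hβ : 0 < β) (hβ2 : β ≤ 1 / 2)
    (hx : ∀ s, x s ∈ truncSimplex N T) (hr : ∀ s ≤ n, 0 < r s) (hsurv : Survives T β r x n)
    (hend : alpha r x n (regLeader T adaGamma r n) < ENNReal.ofReal β) :
    ∃ w ∈ nearOptimal T r n (52 * (N * Real.log T)),
      (∀ s < n, β * wealthRatio (r s) (x s) w ≤ 1) ∧
        ∃ s ≤ n, β⁻¹ ≤ 8 * max 1 (wealthRatio (r s) (x s) w) := by
  have hxpos : ∀ s i, 0 < x s i := fun s => truncSimplex_pos (by lia) (hx s)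
  have hxr : ∀ s ≤ n, 0 < x s ⬝ᵥ r s := fun s hs => dotProduct_pos (hxpos s) (hr s hs)
  have hNL : 0 ≤ N * Real.log T := mul_nonneg (Nat.cast_nonneg N) (Real.log_natCast_nonneg T)
  set b := regLeader T adaGamma r n
  have hb : b ∈ nearOptimal T r n (52 * (N * Real.log T)) :=
    regLeader_adaGamma_mem_nearOptimal_pred hN hNT hr
  have hbpos := truncSimplex_pos (by lia) hb.1
  by_cases hcurv : ∀ s < n, β * wealthRatio (r s) (x s) b ≤ 1
  · exact ⟨b, hb, hcurv, exists_inv_le_max_of_alpha_lt hβ hβ2 hxr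
      (fun s hs => (wealthRatio_pos (hxpos s) hbpos (hr s hs)).le) hend⟩
  push Not at hcurv
  obtain ⟨k, hk, hkb⟩ := hcurv
  obtain ⟨a, ha, hacurv⟩ := hsurv.exists_nearOptimal hN hNT hβ.le hβ2 hx fun s hs => hr s hs.le
  obtain ⟨w, hw, hwle, s, hs, hws⟩ := exists_mem_segment_forall_le_and_eq (c := 1 / β)
    (I := Finset.range n) (f := fun s => wealthRatio (r s) (x s)) (a := a) (b := b)
    (fun s _ => (continuous_wealthRatio _ _).continuousOn)
    (fun s hs => (le_div_iff₀' hβ).2 (hacurv s (Finset.mem_range.1 hs)))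
    ⟨k, Finset.mem_range.2 hk, (div_le_iff₀' hβ).2 hkb.le⟩
  refine ⟨w, (convex_nearOptimal (by lia) (fun s hs => hr s hs.le) _).segment_subset
    (nearOptimal_mono (by linarith) ha) hb hw,
    fun s hs => (le_div_iff₀' hβ).1 (hwle s (Finset.mem_range.2 hs)), s,
    (Finset.mem_range.1 hs).le, ?_⟩
  rw [← one_div, ← hws]
  linarith [le_max_right 1 (wealthRatio (r s) (x s) w), le_max_left 1 (wealthRatio (r s) (x s) w)]

theorem max_one_wealthRatio_le_wealthCap (hT : 1 < T) {s t : ℕ} (hst : s ≤ t)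
    (hx : ∀ i, 0 < x s i) {w : Fin N → ℝ} (hw : w ∈ stdSimplex ℝ (Fin N)) (hN : 0 < N)
    {p : Fin N → ℝ} (hp : 0 < p) : max 1 (wealthRatio p (x s) w) ≤ wealthCap T x w t := by
  refine max_le ?_ (wealthRatio_le_wealthCap hT hst hx hw.1 hp)
  calc (1 : ℝ) ≤ max (N * w ⟨0, hN⟩ * (T : ℝ) ^ rateExp T x t ⟨0, hN⟩) 6 :=
        le_max_of_le_right (by norm_num)
    _ ≤ wealthCap T x w t :=
        Finset.single_le_sum (f := fun i => max (N * w i * (T : ℝ) ^ rateExp T x t i) 6)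
          (fun _ _ => le_max_of_le_right (by norm_num)) (Finset.mem_univ _)

theorem mul_log_le (k : ℕ) (hT : 1 < T) : k * Real.log T ≤ 4 * (k ^ 2 * Real.log T ^ 3) := by
  have hk : (k : ℝ) ≤ k ^ 2 := by exact_mod_cast Nat.le_self_pow two_ne_zero k
  have := Real.log_natCast_nonneg T
  calc k * Real.log T ≤ k ^ 2 * (4 * Real.log T ^ 3) := by
        gcongr
        exact log_le_four_mul_log_pow_three hT
    _ = 4 * (k ^ 2 * Real.log T ^ 3) := by ring

theorem cumRegret_le_of_survives (hN : 0 < N) (hNT : N < T) (hβ : 0 < β) (hβ2 : β ≤ 1 / 2)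
    (hx : x = barrons T β (adaEta N T) r) (hn : n ≤ T) (hr : ∀ s < n, 0 < r s)
    (hsurv : Survives T β r x n) {v : Fin N → ℝ} (hv : v ∈ truncSimplex N T) :
    cumRegret r n x v ≤ 17000 * (N ^ 2 * Real.log T ^ 3) + 3 * (N * Real.log T) * β⁻¹ := by
  have := Real.log_natCast_nonneg T
  have hmem : ∀ s, x s ∈ truncSimplex N T := hx ▸ barrons_mem_truncSimplex hN (by lia) _ _ r
  obtain ⟨a, ha, hcurv⟩ := hsurv.exists_nearOptimal hN hNT hβ.le hβ2 hmem hr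
  have hregret := cumRegret_barrons_adaEta_le hN hNT hβ hβ2 hx ha.1 hn hr hcurv
  have hcap : 0 ≤ 360 * (N * Real.log T) * wealthCap T x a n :=
    mul_nonneg (by positivity) (wealthCap_nonneg T x a n)
  have hNL := mul_log_le N (show 1 < T by lia)
  rw [div_eq_mul_inv] at hregret
  have : 0 ≤ N ^ 2 * Real.log T ^ 3 := by positivity
  linarith [cumRegret_le_of_mem_nearOptimal (x := x) ha hv]

theorem inv_le_of_restart (hN : 0 < N) (hNT : N < T) (hβ : 0 < β) (hβ2 : β ≤ 1 / 2)
    (hx : ∀ s, x s ∈ truncSimplex N T) (hr : ∀ s ≤ n, 0 < r s) (hsurv : Survives T β r x n)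
    (hend : alpha r x n (regLeader T adaGamma r n) < ENNReal.ofReal β) :
    β⁻¹ ≤ 8 * (N * T) := by
  obtain ⟨w, hw, -, s, hs, hfar⟩ :=
    exists_nearOptimal_of_restart hN hNT hβ hβ2 hx hr hsurv hend
  have hNT1 : (1 : ℝ) ≤ N * T := by exact_mod_cast Nat.mul_pos hN (show 0 < T by lia)
  have hmax : max 1 (wealthRatio (r s) (x s) w) ≤ N * T := max_le hNT1
    (wealthRatio_le_of_mem_truncSimplex (by lia) (hr s hs) (hx s) (truncSimplex_le_one hw.1))
  linarith

theorem cumRegret_le_of_restart (hN : 0 < N) (hNT : N < T) (hβ : 0 < β) (hβ2 : β ≤ 1 / 2)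
    (hx : x = barrons T β (adaEta N T) r) (hn : n ≤ T) (hr : ∀ s ≤ n, 0 < r s)
    (hsurv : Survives T β r x n)
    (hend : alpha r x n (regLeader T adaGamma r n) < ENNReal.ofReal β)
    {v : Fin N → ℝ} (hv : v ∈ truncSimplex N T) :
    cumRegret r (n + 1) x v ≤
      17000 * (N ^ 2 * Real.log T ^ 3) - 3 * (N * Real.log T) * β⁻¹ := by
  have hT : 1 < T := by lia
  have : 0 ≤ Real.log T := Real.log_natCast_nonneg T
  have hmem : ∀ s, x s ∈ truncSimplex N T := hx ▸ barrons_mem_truncSimplex hN (by lia) _ _ r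
  obtain ⟨w, hw, hcurv, s, hs, hfar⟩ :=
    exists_nearOptimal_of_restart hN hNT hβ hβ2 hmem hr hsurv hend
  have hregret := cumRegret_barrons_adaEta_le hN hNT hβ hβ2 hx hw.1 hn
    (fun s hs => hr s hs.le) hcurv
  have hcap : 360 * (N * Real.log T) * (β⁻¹ / 8) ≤
      360 * (N * Real.log T) * wealthCap T x w n := by
    gcongr
    linarith [max_one_wealthRatio_le_wealthCap hT hs (truncSimplex_pos (by lia) (hmem s)) hw.1.1
      hN (hr s hs)]
  have hlast : loss (r n) (x n) - loss (r n) v ≤ 2 * (N * Real.log T) :=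
    (loss_sub_loss_le_log (by lia) (hmem n) hv (hr n le_rfl)).trans
      (log_mul_le_two_mul_mul_log hN hNT.le)
  have hsplit : cumRegret r (n + 1) x v =
      cumRegret r n x v + (loss (r n) (x n) - loss (r n) v) := Finset.sum_range_succ _ _
  have hNL := mul_log_le N hT
  have hP : 0 ≤ N ^ 2 * Real.log T ^ 3 := by positivity
  have hNLβ : 0 ≤ N * Real.log T * β⁻¹ := by positivity
  rw [div_eq_mul_inv] at hregret
  linarith [cumRegret_le_of_mem_nearOptimal (x := x) hw hv]

end Epoch

/-! ### The epochs of Ada-BARRONS -/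

section Epochs

variable {N T : ℕ} {r : ℕ → Fin N → ℝ} {t : ℕ} {v : Fin N → ℝ}

theorem adaState_succ_of_restarts (h : (adaState T r t).Restarts T r) :
    adaState T r (t + 1) =
      ⟨(adaState T r t).β / 2, (adaState T r t).start + (adaState T r t).round + 1, 0⟩ := by
  rw [adaState, if_pos h]

theorem adaState_succ_of_not_restarts (h : ¬(adaState T r t).Restarts T r) :
    adaState T r (t + 1) =
      ⟨(adaState T r t).β, (adaState T r t).start, (adaState T r t).round + 1⟩ := by
  rw [adaState, if_neg h]

theorem adaState_start_add_round (T : ℕ) (r : ℕ → Fin N → ℝ) (t : ℕ) :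
    (adaState T r t).start + (adaState T r t).round = t := by
  induction t with
  | zero => rfl
  | succ t ih =>
    by_cases h : (adaState T r t).Restarts T r
    · rw [adaState_succ_of_restarts h, ih, add_zero]
    · rw [adaState_succ_of_not_restarts h, ← add_assoc, ih]

theorem adaState_β_mem_Ioc (T : ℕ) (r : ℕ → Fin N → ℝ) (t : ℕ) :
    (adaState T r t).β ∈ Set.Ioc 0 (1 / 2) := by
  induction t with
  | zero => norm_num [adaState]
  | succ t ih =>
    by_cases h : (adaState T r t).Restarts T r
    · rw [adaState_succ_of_restarts h]
      exact ⟨half_pos ih.1, (half_le_self ih.1.le).trans ih.2⟩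
    · rwa [adaState_succ_of_not_restarts h]

theorem adaState_start_add (T : ℕ) (r : ℕ → Fin N → ℝ) (t : ℕ) :
    ∀ s ≤ (adaState T r t).round, adaState T r ((adaState T r t).start + s) =
      ⟨(adaState T r t).β, (adaState T r t).start, s⟩ := by
  induction t with
  | zero =>
    intro s hs
    obtain rfl : s = 0 := Nat.le_zero.1 hs
    rfl
  | succ t ih =>
    by_cases h : (adaState T r t).Restarts T r
    · intro s hs
      obtain rfl : s = 0 := by simpa only [adaState_succ_of_restarts h, Nat.le_zero] using hs
      rw [adaState_succ_of_restarts h, add_zero, adaState_start_add_round,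
        adaState_succ_of_restarts h, adaState_start_add_round]
    · intro s hs
      rw [adaState_succ_of_not_restarts h] at hs ⊢
      obtain hlt | rfl := Nat.le_succ_iff.1 hs
      · exact ih s hlt
      · rw [Nat.succ_eq_add_one, ← add_assoc, adaState_start_add_round,
          adaState_succ_of_not_restarts h]

theorem adaBarrons_start_add {s : ℕ} (hs : s ≤ (adaState T r t).round) :
    adaBarrons T r ((adaState T r t).start + s) = (adaState T r t).epochPlays T r s := by
  rw [adaBarrons, adaState_start_add T r t s hs]
  rfl

theorem adaState_survives (T : ℕ) (r : ℕ → Fin N → ℝ) (t : ℕ) :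
    Survives T (adaState T r t).β ((adaState T r t).epochPrices r) ((adaState T r t).epochPlays T r)
      (adaState T r t).round := by
  induction t with
  | zero => exact fun m hm => absurd hm (Nat.not_lt_zero m)
  | succ t ih =>
    by_cases h : (adaState T r t).Restarts T r
    · rw [adaState_succ_of_restarts h]
      exact fun m hm => absurd hm (Nat.not_lt_zero m)
    · rw [adaState_succ_of_not_restarts h]
      intro m hm
      obtain hlt | rfl := Nat.lt_succ_iff_lt_or_eq.1 hm
      · exact ih m hlt
      · exact not_lt.1 h

theorem epochPlays_mem_truncSimplex (hN : 0 < N) (hT : 0 < T) (r : ℕ → Fin N → ℝ) (S : AdaState)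
    (s : ℕ) : S.epochPlays T r s ∈ truncSimplex N T :=
  barrons_mem_truncSimplex hN hT _ _ _ s

theorem inv_adaState_β_le (hN : 0 < N) (hNT : N < T) (hr : ∀ t < T, 0 < r t) (ht : t ≤ T) :
    (adaState T r t).β⁻¹ ≤ 16 * (N * T) := by
  induction t with
  | zero =>
    have hNT1 : (1 : ℝ) ≤ N * T := by exact_mod_cast Nat.mul_pos hN (show 0 < T by lia)
    simp only [adaState, one_div, inv_inv]
    linarith
  | succ t ih =>
    have hstart := adaState_start_add_round T r t
    by_cases h : (adaState T r t).Restarts T r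
    · have hβ := adaState_β_mem_Ioc T r t
      have hinv := inv_le_of_restart hN hNT hβ.1 hβ.2
        (fun s => epochPlays_mem_truncSimplex hN (by lia) r _ s)
        (fun s hs => hr _ (by lia)) (adaState_survives T r t) h
      rw [adaState_succ_of_restarts h, inv_div, div_eq_mul_inv]
      linarith
    · rw [adaState_succ_of_not_restarts h]
      exact ih (by lia)

theorem cumRegret_add (r x : ℕ → Fin N → ℝ) (m n : ℕ) (v : Fin N → ℝ) :
    cumRegret r (m + n) x v =
      cumRegret r m x v + cumRegret (fun s => r (m + s)) n (fun s => x (m + s)) v :=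
  Finset.sum_range_add _ _ _

theorem cumRegret_start_add {n : ℕ} (hn : n ≤ (adaState T r t).round + 1) :
    cumRegret r ((adaState T r t).start + n) (adaBarrons T r) v =
      cumRegret r (adaState T r t).start (adaBarrons T r) v +
        cumRegret ((adaState T r t).epochPrices r) n ((adaState T r t).epochPlays T r) v := by
  rw [cumRegret_add]
  congr 1
  refine Finset.sum_congr rfl fun s hs => ?_
  have hs := Finset.mem_range.1 hs
  simp only [adaBarrons_start_add (show s ≤ (adaState T r t).round by lia), AdaState.epochPrices]

-- The negative term, accumulated geometrically over the completed epochs, pays for the term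
-- `3 N (ln T) / β` of the unfinished epoch.
theorem cumRegret_start_le (hN : 0 < N) (hNT : N < T) (hr : ∀ t < T, 0 < r t)
    (hv : v ∈ truncSimplex N T) (ht : t ≤ T) :
    cumRegret r (adaState T r t).start (adaBarrons T r) v ≤
      (Real.logb 2 (adaState T r t).β⁻¹ - 1) * (17000 * (N ^ 2 * Real.log T ^ 3)) -
        3 * (N * Real.log T) * ((adaState T r t).β⁻¹ - 2) := by
  induction t with
  | zero => simp [adaState, cumRegret]
  | succ t ih =>
    have hstart := adaState_start_add_round T r t
    by_cases h : (adaState T r t).Restarts T r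
    · have hβ := adaState_β_mem_Ioc T r t
      have hepoch := cumRegret_le_of_restart (r := (adaState T r t).epochPrices r)
        (x := (adaState T r t).epochPlays T r) hN hNT hβ.1 hβ.2 rfl (by lia)
        (fun s hs => hr _ (by lia)) (adaState_survives T r t) h hv
      have hlogb : Real.logb 2 ((adaState T r t).β / 2)⁻¹ =
          1 + Real.logb 2 (adaState T r t).β⁻¹ := by
        rw [inv_div, div_eq_mul_inv, Real.logb_mul two_ne_zero (inv_pos.2 hβ.1).ne',
          Real.logb_self_eq_one one_lt_two]
      rw [adaState_succ_of_restarts h, add_assoc, cumRegret_start_add le_rfl, hlogb, inv_div,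
        div_eq_mul_inv]
      linarith [ih (by lia)]
    · rw [adaState_succ_of_not_restarts h]
      exact ih (by lia)

theorem logb_inv_adaState_β_le (hN : 0 < N) (hNT : N < T) (hr : ∀ t < T, 0 < r t) (ht : t ≤ T) :
    Real.logb 2 (adaState T r t).β⁻¹ ≤ 9 * Real.log T := by
  have hT : (2 : ℝ) ≤ T := by exact_mod_cast (show 2 ≤ T by lia)
  have hNT' : (N : ℝ) ≤ T := by exact_mod_cast hNT.le
  have hβ := inv_pos.2 (adaState_β_mem_Ioc T r t).1
  have hinv : (adaState T r t).β⁻¹ ≤ (T : ℝ) ^ 6 :=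
    calc (adaState T r t).β⁻¹ ≤ 2 ^ 4 * (N * T) := by
          linarith [inv_adaState_β_le hN hNT hr ht]
      _ ≤ T ^ 4 * (T * T) := by gcongr
      _ = (T : ℝ) ^ 6 := by ring
  have hlog : Real.log (adaState T r t).β⁻¹ ≤ 6 * Real.log T := by
    simpa only [Real.log_pow, Nat.cast_ofNat] using Real.log_le_log hβ hinv
  rw [Real.logb, div_le_iff₀ (Real.log_pos one_lt_two)]
  nlinarith [Real.log_two_gt_d9, Real.log_natCast_nonneg T]

theorem cumRegret_adaBarrons_le (hN : 0 < N) (hNT : N < T) (hr : ∀ t < T, 0 < r t)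
    (hv : v ∈ truncSimplex N T) :
    cumRegret r T (adaBarrons T r) v ≤ 154000 * (N ^ 2 * Real.log T ^ 4) := by
  have hL := half_le_log (show 1 < T by lia)
  have hstart := adaState_start_add_round T r T
  have hβ := adaState_β_mem_Ioc T r T
  have hcompleted := cumRegret_start_le hN hNT hr hv le_rfl
  have hcurrent := cumRegret_le_of_survives (r := (adaState T r T).epochPrices r)
    (x := (adaState T r T).epochPlays T r) hN hNT hβ.1 hβ.2 rfl (by lia)
    (fun s hs => hr _ (by lia)) (adaState_survives T r T) hv
  have hsplit := cumRegret_start_add (r := r) (T := T) (t := T) (v := v) (Nat.le_succ _)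
  rw [hstart] at hsplit
  set P : ℝ := N ^ 2 * Real.log T ^ 3 with hP
  have hP0 : 0 ≤ P := by positivity
  calc cumRegret r T (adaBarrons T r) v
      ≤ Real.logb 2 (adaState T r T).β⁻¹ * (17000 * P) + 6 * (N * Real.log T) := by linarith
    _ ≤ 9 * Real.log T * (17000 * P) + 6 * (4 * P) := by
        gcongr ?_ * _ + 6 * ?_
        exacts [logb_inv_adaState_β_le hN hNT hr le_rfl, mul_log_le N (show 1 < T by lia)]
    _ ≤ 9 * Real.log T * (17000 * P) + 6 * (4 * (2 * Real.log T * P)) := by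
        gcongr
        exact le_mul_of_one_le_left hP0 (by linarith)
    _ = 153048 * (N ^ 2 * Real.log T ^ 4) := by
        rw [hP]
        ring
    _ ≤ 154000 * (N ^ 2 * Real.log T ^ 4) := by
        gcongr
        norm_num

end Epochs

/-! ### Arbitrary comparators -/

section Comparators

variable {N T : ℕ} {r x : ℕ → Fin N → ℝ} {u : Fin N → ℝ}

theorem loss_le_loss_sub_log {r u v : Fin N → ℝ} {c : ℝ} (hc : 0 < c) (hu : 0 < u ⬝ᵥ r)
    (h : c * (u ⬝ᵥ r) ≤ v ⬝ᵥ r) : loss r v ≤ loss r u - Real.log c := by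
  have hlog := Real.log_le_log (mul_pos hc hu) h
  rw [Real.log_mul hc.ne' hu.ne'] at hlog
  unfold loss
  linarith

theorem mixture_mem_truncSimplex (hN : 0 < N) (hT : 0 < T) (hu : u ∈ stdSimplex ℝ (Fin N)) :
    (1 - 1 / (T : ℝ)) • u + (1 / (T : ℝ)) • (fun _ => 1 / (N : ℝ)) ∈ truncSimplex N T := by
  have hT' : 1 / (T : ℝ) ≤ 1 := div_le_self zero_le_one (by exact_mod_cast hT)
  refine ⟨convex_stdSimplex ℝ (Fin N) hu (uniform_mem_truncSimplex hN hT).1 (sub_nonneg.2 hT')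
    (by positivity) (sub_add_cancel _ _), fun i => ?_⟩
  calc 1 / ((N : ℝ) * T) = 1 / (T : ℝ) * (1 / N) := by rw [one_div_mul_one_div, mul_comm]
    _ ≤ (1 - 1 / (T : ℝ)) * u i + 1 / (T : ℝ) * (1 / N) :=
      le_add_of_nonneg_left (mul_nonneg (sub_nonneg.2 hT') (hu.1 i))

theorem exists_mem_truncSimplex_cumLoss_le (hN : 0 < N) (hT : 1 < T) (hr : ∀ t < T, 0 < r t)
    (hu : u ∈ stdSimplex ℝ (Fin N)) (hur : ∀ t < T, 0 < u ⬝ᵥ r t) :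
    ∃ v ∈ truncSimplex N T, cumLoss r T v ≤ cumLoss r T u + 2 := by
  refine ⟨_, mixture_mem_truncSimplex hN (by lia) hu, ?_⟩
  have hT2 : (2 : ℝ) ≤ T := by exact_mod_cast hT
  have hinv : 1 / (T : ℝ) ≤ 1 / 2 := one_div_le_one_div_of_le two_pos hT2
  have hround : ∀ t ∈ Finset.range T,
      loss (r t) ((1 - 1 / (T : ℝ)) • u + (1 / (T : ℝ)) • (fun _ => 1 / (N : ℝ))) ≤
        loss (r t) u + 2 * (1 / T) := by
    intro t ht
    have ht := Finset.mem_range.1 ht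
    have huniform : 0 ≤ (fun _ => 1 / (N : ℝ)) ⬝ᵥ r t :=
      dotProduct_nonneg_of_nonneg (fun _ => by positivity) (hr t ht).le
    have hloss := loss_le_loss_sub_log (c := 1 - 1 / (T : ℝ)) (by linarith) (hur t ht)
      (v := (1 - 1 / (T : ℝ)) • u + (1 / (T : ℝ)) • (fun _ => 1 / (N : ℝ))) (by
        rw [add_dotProduct, smul_dotProduct, smul_dotProduct, smul_eq_mul, smul_eq_mul]
        exact le_add_of_nonneg_right (by positivity))
    linarith [neg_log_one_sub_le (by positivity) hinv]
  calc cumLoss r T _ ≤ ∑ t ∈ Finset.range T, (loss (r t) u + 2 * (1 / (T : ℝ))) :=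
        Finset.sum_le_sum hround
    _ = cumLoss r T u + 2 := by
      rw [Finset.sum_add_distrib, Finset.sum_const, Finset.card_range, nsmul_eq_mul, cumLoss]
      field_simp

theorem extLoss_ne_bot (r x : Fin N → ℝ) : extLoss r x ≠ ⊥ := by
  rw [extLoss, Ne, EReal.neg_eq_bot_iff, ENNReal.log_eq_top_iff]
  exact ENNReal.ofReal_ne_top

theorem sum_extLoss_eq_coe {n : ℕ} (h : ∀ t < n, 0 < x t ⬝ᵥ r t) :
    ∑ t ∈ Finset.range n, extLoss (r t) (x t) =
      ((∑ t ∈ Finset.range n, loss (r t) (x t) : ℝ) : EReal) := by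
  induction n with
  | zero => rfl
  | succ n ih =>
    rw [Finset.sum_range_succ, Finset.sum_range_succ, EReal.coe_add,
      ih fun t ht => h t (ht.trans n.lt_succ_self), extLoss_eq_loss (h n n.lt_succ_self)]

theorem sum_extLoss_eq_top {n t : ℕ} (ht : t < n) (h : u ⬝ᵥ r t = 0) :
    ∑ s ∈ Finset.range n, extLoss (r s) u = ⊤ := by
  have hrest : ∑ s ∈ (Finset.range n).erase t, extLoss (r s) u ≠ ⊥ :=
    Finset.sum_induction _ (· ≠ ⊥) (fun a b ha hb hab => (EReal.add_eq_bot_iff.1 hab).elim ha hb)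
      EReal.zero_ne_bot fun s _ => extLoss_ne_bot _ _
  rw [← Finset.add_sum_erase _ _ (Finset.mem_range.2 ht), extLoss_eq_top h,
    EReal.top_add_of_ne_bot hrest]

theorem regret_eq_cumRegret (hx : ∀ t < T, 0 < x t ⬝ᵥ r t) (hu : ∀ t < T, 0 < u ⬝ᵥ r t) :
    regret T r x u = (cumRegret r T x u : EReal) := by
  rw [regret, sum_extLoss_eq_coe hx, sum_extLoss_eq_coe (x := fun _ => u) hu, ← EReal.coe_sub,
    ← Finset.sum_sub_distrib, cumRegret]

theorem regret_eq_bot {t : ℕ} (ht : t < T) (h : u ⬝ᵥ r t = 0) : regret T r x u = ⊥ := by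
  rw [regret, sum_extLoss_eq_top ht h, EReal.sub_top]

theorem cumRegret_adaBarrons_le_of_mem_stdSimplex (hN : 0 < N) (hNT : N < T)
    (hr : ∀ t < T, 0 < r t) (hu : u ∈ stdSimplex ℝ (Fin N)) (hur : ∀ t < T, 0 < u ⬝ᵥ r t) :
    cumRegret r T (adaBarrons T r) u ≤ 160000 * (N ^ 2 * Real.log T ^ 4) := by
  obtain ⟨v, hv, hvu⟩ := exists_mem_truncSimplex_cumLoss_le hN (by lia) hr hu hur
  have hone : (1 : ℝ) * (1 / 2) ^ 4 ≤ N ^ 2 * Real.log T ^ 4 := by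
    gcongr
    exacts [one_le_pow₀ (by exact_mod_cast hN), half_le_log (by lia)]
  rw [cumRegret_eq_add_cumLoss_sub r _ T u v]
  linarith [cumRegret_adaBarrons_le hN hNT hr hv]

theorem regret_adaBarrons_le (hN : 0 < N) (hNT : N < T) (hr : ∀ t < T, 0 < r t)
    (hu : u ∈ stdSimplex ℝ (Fin N)) :
    regret T r (adaBarrons T r) u ≤ ((160000 * (N ^ 2 * Real.log T ^ 4) : ℝ) : EReal) := by
  have hT : 0 < T := by lia
  by_cases hur : ∀ t < T, 0 < u ⬝ᵥ r t
  · rw [regret_eq_cumRegret (x := adaBarrons T r) (fun t ht => dotProduct_pos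
      (truncSimplex_pos hT (epochPlays_mem_truncSimplex hN hT r _ _)) (hr t ht)) hur,
      EReal.coe_le_coe_iff]
    exact cumRegret_adaBarrons_le_of_mem_stdSimplex hN hNT hr hu hur
  · push Not at hur
    obtain ⟨t, ht, hur⟩ := hur
    rw [regret_eq_bot ht (hur.antisymm (dotProduct_nonneg_of_nonneg hu.1 (hr t ht).le))]
    exact bot_le

end Comparators

end AdaBarrons

/-- There is an absolute constant `C` such that, for any number `N` of stocks, any horizon `T > N` and any
sequence of nonzero price relative vectors, the regret of Ada-BARRONS against every
constant-rebalanced portfolio `u` is at most `C N² (ln T)⁴`. -/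
theorem theorem2 :
    ∃ C : ℝ, 0 < C ∧
      ∀ (N T : ℕ), 0 < N → N < T →
        ∀ r : ℕ → Fin N → ℝ,
          (∀ t < T, (∀ i, 0 ≤ r t i) ∧ ∃ i, 0 < r t i) →
            ∀ u ∈ stdSimplex ℝ (Fin N),
              AdaBarrons.regret T r (AdaBarrons.adaBarrons T r) u ≤
                ((C * (N : ℝ) ^ 2 * Real.log T ^ 4 : ℝ) : EReal) := by
  refine ⟨160000, by norm_num, fun N T hN hNT r hr u hu => ?_⟩
  rw [mul_assoc]
  exact AdaBarrons.regret_adaBarrons_le hN hNT (fun t ht => Pi.lt_def.2 (hr t ht)) hu
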